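/- Let $J_0(t)=\frac2\pi\int_0^{\pi/2}\cos(t\cos\varphi)\,d\varphi$, $I_0(t)=\frac1\pi\int_0^{\pi}e^{t\cos\theta}\,d\theta$ and, for $t>0$, $K_0(t)=\int_0^\infty e^{-t\cosh u}\,du$ be the Bessel function and the modified Bessel functions of order zero, and let $$p_7(x)=\int_0^\infty J_0(xt)\,[J_0(t)]^7\,xt\,dt$$ be Kluyver's probability density for the distance travelled by a 7-step planar uniform random walk with unit steps. (a) For every $x\in[0,1]$, the integral defining $p_7(x)$ and the two integrals below converge absolutely, and $$\frac{p_7(x)}{35}=\frac{4}{\pi^6}\int_0^\infty I_0(xt)\,I_0(t)\,[K_0(t)]^6\,xt\,dt-\frac{2}{\pi^4}\int_0^\infty I_0(xt)\,[I_0(t)]^3\,[K_0(t)]^4\,xt\,dt .$$ (b) For every integer $k\ge 0$, the integral in $$r_{7,k}=\frac{140}{4^k (k!)^2\pi^6}\int_0^\infty\Big\{I_0(t)[K_0(t)]^6-\frac{\pi^2}{2}[I_0(t)]^3[K_0(t)]^4\Big\}t^{2k+1}\,dt$$ converges absolutely, and the Maclaurin series $\sum_{k=0}^\infty r_{7,k}x^{2k+1}$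 converges to $p_7(x)$ uniformly for $x\in[0,1]$. -/

import Mathlib

open MeasureTheory Filter Topology Set

noncomputable section

/-- The Bessel function of the first kind and zeroth order. -/
def besselJ0 (t : ℝ) : ℝ :=
  2 / Real.pi * ∫ φ in (0 : ℝ)..(Real.pi / 2), Real.cos (t * Real.cos φ)

/-- The modified Bessel function of the first kind and zeroth order. -/
def besselI0 (t : ℝ) : ℝ :=
  1 / Real.pi * ∫ θ in (0 : ℝ)..Real.pi, Real.exp (t * Real.cos θ)

/-- The modified Bessel function of the second kind and zeroth order; the integral converges
for `0 < t`, and only such arguments are used below. -/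
def besselK0 (t : ℝ) : ℝ :=
  ∫ u in Ioi (0 : ℝ), Real.exp (-t * Real.cosh u)

/-- The integrand of Kluyver's formula for the 7-step density. -/
def kluyverIntegrand7 (x t : ℝ) : ℝ :=
  besselJ0 (x * t) * besselJ0 t ^ 7 * (x * t)

/-- Kluyver's probability density for the distance travelled by a 7-step planar uniform
random walk. -/
def p7 (x : ℝ) : ℝ :=
  ∫ t in Ioi (0 : ℝ), kluyverIntegrand7 x t

/-- The integrand of the Bessel moment occurring in the `k`-th coefficient. -/
def momentIntegrand7 (k : ℕ) (t : ℝ) : ℝ :=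
  (besselI0 t * besselK0 t ^ 6 - Real.pi ^ 2 / 2 * (besselI0 t ^ 3 * besselK0 t ^ 4))
    * t ^ (2 * k + 1)

/-- The coefficients of the Maclaurin series of the 7-step density. -/
def r7 (k : ℕ) : ℝ :=
  140 / (4 ^ k * (k.factorial : ℝ) ^ 2 * Real.pi ^ 6) *
    ∫ t in Ioi (0 : ℝ), momentIntegrand7 k t

end

/-! For `t > 0`, `J₀ t` is the real part of the Hankel function `H = hankelH0`, while at `it` one
has `J₀ = I₀ t` and `H = -(2i/π) K₀ t`. The identity in (a) is therefore a rotation of the contour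
from the positive real axis to the positive imaginary axis. `J₀ ^ 7` itself cannot be rotated, since
it grows exponentially upwards. It is replaced by the form `P = besselPoly` of degree 7, each of
whose monomials has at least four factors `h`, and for which `Re P(j, j + iy) = j ^ 7 / 35`.

Cauchy's theorem is applied to `J₀(xz) z P(J₀ z, H z)` on the square `[0, R]²`, and real parts are
taken. The bottom side gives Kluyver's integral and the left side the `I₀`, `K₀` integrals. The
other two sides vanish in the limit by `norm_quadrantKernel_le`. The delicate term is `J₀(xz) J₀³
H⁴`: at `x = 1` its exponentials can balance exactly, so an additional power of decay is taken from
`I₀ y ≤ e^y y^(-1/2)`.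

The analytic input on `H` comes from one formula, `complexK0 w = 2 e^(-w) ∫ e^(-s²) (s² + 2w)^(-1/2)
ds` on `Re w ≥ 0`, `w ≠ 0`. It gives holomorphy, continuity up to the boundary and decay. It is
matched with `K₀` by a substitution (`complexK0_ofReal`) and with `J₀` by a contour in a half-strip
(`complexK0_neg_I_mul_im`).

For (b), the power series of `I₀(xt)` is integrated term by term. Its terms are nonnegative, so
absolute convergence of the integral at `x = 1` controls the whole series on `[0, 1]`. -/

/-! ### `J₀` on the complex plane and bounds for `I₀` -/

/-- The Bessel function `J₀` at complex arguments. -/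
noncomputable def complexJ0 (z : ℂ) : ℂ :=
  2 / Real.pi * ∫ φ in (0 : ℝ)..(Real.pi / 2), Complex.cos (z * Real.cos φ)

theorem complexJ0_ofReal (t : ℝ) : complexJ0 t = besselJ0 t := by
  unfold complexJ0 besselJ0
  push_cast
  rw [← intervalIntegral.integral_ofReal]
  simp

theorem norm_complex_cos_le (z : ℂ) : ‖Complex.cos z‖ ≤ Real.cosh z.im := by
  rw [Complex.cos, norm_div, Real.cosh_eq]
  have h := norm_add_le (Complex.exp (z * Complex.I)) (Complex.exp (-z * Complex.I))
  rw [Complex.norm_exp, Complex.norm_exp] at h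
  simp at h
  simp
  linarith

theorem norm_complex_sin_le (z : ℂ) : ‖Complex.sin z‖ ≤ Real.cosh z.im := by
  rw [Complex.sin, norm_div, norm_mul, Real.cosh_eq]
  have h := norm_sub_le (Complex.exp (-z * Complex.I)) (Complex.exp (z * Complex.I))
  rw [Complex.norm_exp, Complex.norm_exp] at h
  simp at h
  simp
  linarith

/-- The reflection `θ ↦ π - θ` folds `[0, π]` onto `[0, π/2]`, the interval used for `J₀`. -/
theorem besselI0_eq_cosh (t : ℝ) :
    besselI0 t = 2 / Real.pi * ∫ φ in (0 : ℝ)..(Real.pi / 2), Real.cosh (t * Real.cos φ) := by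
  have hc : Continuous fun θ : ℝ => Real.exp (t * Real.cos θ) := by fun_prop
  have hc' : Continuous fun θ : ℝ => Real.exp (-(t * Real.cos θ)) := by fun_prop
  have h1 : ∫ θ in (Real.pi / 2)..Real.pi, Real.exp (t * Real.cos θ) =
      ∫ θ in (0 : ℝ)..(Real.pi / 2), Real.exp (-(t * Real.cos θ)) := by
    have := intervalIntegral.integral_comp_sub_left (a := 0) (b := Real.pi / 2)
      (fun θ : ℝ => Real.exp (t * Real.cos θ)) Real.pi
    rw [show Real.pi - Real.pi / 2 = Real.pi / 2 by ring, sub_zero] at this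
    rw [← this]
    simp [Real.cos_pi_sub]
  unfold besselI0
  rw [← intervalIntegral.integral_add_adjacent_intervals (b := Real.pi / 2)
    (hc.intervalIntegrable _ _) (hc.intervalIntegrable _ _), h1,
    ← intervalIntegral.integral_add (hc.intervalIntegrable _ _) (hc'.intervalIntegrable _ _)]
  simp only [Real.cosh_eq]
  rw [intervalIntegral.integral_div]
  ring

theorem complexJ0_mul_I (t : ℝ) : complexJ0 (t * Complex.I) = besselI0 t := by
  rw [besselI0_eq_cosh]
  unfold complexJ0
  push_cast
  rw [← intervalIntegral.integral_ofReal]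
  congr 1
  refine intervalIntegral.integral_congr fun φ _ => ?_
  simp only [Complex.ofReal_cosh, Complex.ofReal_mul, Complex.ofReal_cos]
  rw [← Complex.cos_mul_I]
  congr 1
  ring

theorem norm_complexJ0_le (z : ℂ) : ‖complexJ0 z‖ ≤ besselI0 z.im := by
  rw [besselI0_eq_cosh]
  unfold complexJ0
  have hpi := Real.pi_pos
  rw [norm_mul]
  have : ‖(2 / Real.pi : ℂ)‖ = 2 / Real.pi := by
    simp [abs_of_pos hpi]
  rw [this]
  gcongr
  refine intervalIntegral.norm_integral_le_of_norm_le (by positivity) ?_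
    (Continuous.intervalIntegrable (by fun_prop) _ _)
  refine Eventually.of_forall fun φ _ => (norm_complex_cos_le _).trans ?_
  simp [-Complex.ofReal_cos]

theorem besselI0_nonneg (t : ℝ) : 0 ≤ besselI0 t :=
  (norm_nonneg _).trans ((norm_complexJ0_le (t * Complex.I)).trans (by simp))

theorem besselI0_le_exp {t : ℝ} (ht : 0 ≤ t) : besselI0 t ≤ Real.exp t := by
  have h : ∫ θ in (0 : ℝ)..Real.pi, Real.exp (t * Real.cos θ) ≤
      ∫ θ in (0 : ℝ)..Real.pi, Real.exp t := by
    refine intervalIntegral.integral_mono_on Real.pi_pos.le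
      (Continuous.intervalIntegrable (by fun_prop) _ _) (by simp) fun θ _ => ?_
    exact Real.exp_le_exp.2 (mul_le_of_le_one_right ht (Real.cos_le_one θ))
  unfold besselI0
  have hpi := Real.pi_pos
  simp only [intervalIntegral.integral_const, smul_eq_mul, sub_zero] at h
  rw [div_mul_eq_mul_div, div_le_iff₀ hpi]
  linarith

/-- Since `cos θ ≤ 1 - 2θ²/π²` on `[0, π]`, the integral is dominated by a Gaussian of width of
order `t^(-1/2)`. This gain over `e^t` settles the terms whose exponentials cancel exactly. -/
theorem besselI0_le_exp_mul_rpow {t : ℝ} (ht : 0 < t) :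
    besselI0 t ≤ Real.exp t * t ^ (-(1 / 2) : ℝ) := by
  have hpi := Real.pi_pos
  set b : ℝ := 2 * t / Real.pi ^ 2 with hb
  have hb0 : 0 < b := by positivity
  have h : ∫ θ in (0 : ℝ)..Real.pi, Real.exp (t * Real.cos θ) ≤
      ∫ θ in (0 : ℝ)..Real.pi, Real.exp t * Real.exp (-b * θ ^ 2) := by
    refine intervalIntegral.integral_mono_on hpi.le
      (Continuous.intervalIntegrable (by fun_prop) _ _)
      (Continuous.intervalIntegrable (by fun_prop) _ _) fun θ hθ => ?_
    rw [← Real.exp_add]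
    refine Real.exp_le_exp.2 ?_
    have := Real.cos_le_one_sub_mul_cos_sq (x := θ) (by rw [abs_of_nonneg hθ.1]; exact hθ.2)
    have := mul_le_mul_of_nonneg_left this ht.le
    refine this.trans (le_of_eq ?_)
    rw [hb]; ring
  have h2 : ∫ θ in (0 : ℝ)..Real.pi, Real.exp (-b * θ ^ 2) ≤ √(Real.pi / b) / 2 := by
    rw [← integral_gaussian_Ioi, intervalIntegral.integral_of_le hpi.le]
    exact setIntegral_mono_set (integrable_exp_neg_mul_sq hb0).integrableOn
      (Eventually.of_forall fun _ => (Real.exp_pos _).le) Ioc_subset_Ioi_self.eventuallyLE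
  rw [intervalIntegral.integral_const_mul] at h
  have h3 : √(Real.pi / b) ≤ 2 * Real.pi * t ^ (-(1 / 2) : ℝ) := by
    rw [Real.rpow_neg ht.le, ← Real.sqrt_eq_rpow]
    refine Real.sqrt_le_iff.2 ⟨by positivity, ?_⟩
    rw [mul_pow, inv_pow, Real.sq_sqrt ht.le, hb]
    rw [show Real.pi / (2 * t / Real.pi ^ 2) = Real.pi ^ 2 * (Real.pi / 2) * t⁻¹ by
      field_simp, show (2 * Real.pi) ^ 2 * t⁻¹ = Real.pi ^ 2 * 4 * t⁻¹ by ring]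
    have := Real.pi_le_four
    gcongr
    linarith
  unfold besselI0
  rw [div_mul_eq_mul_div, one_mul, div_le_iff₀ hpi]
  calc _ ≤ _ := h
    _ ≤ Real.exp t * ((2 * Real.pi * t ^ (-(1 / 2) : ℝ)) / 2) := by gcongr; linarith
    _ = _ := by ring

theorem differentiable_complexJ0 : Differentiable ℂ complexJ0 := by
  intro z
  refine DifferentiableAt.const_mul ?_ _
  refine (intervalIntegral.hasDerivAt_integral_of_dominated_loc_of_deriv_le
    (F := fun (w : ℂ) (φ : ℝ) => Complex.cos (w * Real.cos φ))
    (F' := fun (w : ℂ) (φ : ℝ) => -Complex.sin (w * Real.cos φ) * Real.cos φ)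
    -- On the unit disc about `z` imaginary parts are at most `|z.im| + 1` in absolute value.
    (bound := fun _ => Real.cosh (|z.im| + 1)) (Metric.ball_mem_nhds z one_pos)
    (Eventually.of_forall fun w => Continuous.aestronglyMeasurable (by fun_prop))
    (Continuous.intervalIntegrable (by fun_prop) _ _)
    (Continuous.aestronglyMeasurable (by fun_prop)) ?_ (by simp) ?_).2.differentiableAt
  · refine Eventually.of_forall fun φ _ w hw => ?_
    rw [norm_mul, norm_neg]
    have h1 : ‖((Real.cos φ : ℝ) : ℂ)‖ ≤ 1 := by
      rw [Complex.norm_real]; exact Real.abs_cos_le_one φ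
    have h2 : |w.im| ≤ |z.im| + 1 := by
      have h3 := Complex.abs_im_le_norm (w - z)
      rw [Metric.mem_ball, dist_eq_norm] at hw
      rw [Complex.sub_im] at h3
      have := abs_add_le (w.im - z.im) z.im
      rw [sub_add_cancel] at this
      linarith
    refine (mul_le_of_le_one_right (norm_nonneg _) h1).trans ((norm_complex_sin_le _).trans ?_)
    rw [Real.cosh_le_cosh, Complex.im_mul_ofReal, abs_mul,
      abs_of_nonneg (a := |z.im| + 1) (by positivity)]
    exact (mul_le_of_le_one_right (abs_nonneg _) (Real.abs_cos_le_one φ)).trans h2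
  · refine Eventually.of_forall fun φ _ w _ => ?_
    have := (Complex.hasDerivAt_cos (w * Real.cos φ)).comp w
      ((hasDerivAt_id w).mul_const ((Real.cos φ : ℝ) : ℂ))
    simpa [Function.comp_def] using this

@[fun_prop]
theorem continuous_complexJ0 : Continuous complexJ0 := differentiable_complexJ0.continuous

@[fun_prop]
theorem continuous_besselJ0 : Continuous besselJ0 := by
  have : besselJ0 = fun t : ℝ => (complexJ0 t).re := by
    ext t; simp [complexJ0_ofReal]
  rw [this]; fun_prop

@[fun_prop]
theorem continuous_besselI0 : Continuous besselI0 := by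
  have : besselI0 = fun t : ℝ => (complexJ0 (t * Complex.I)).re := by
    ext t; simp [complexJ0_mul_I]
  rw [this]; fun_prop

theorem abs_besselJ0_le_one (t : ℝ) : |besselJ0 t| ≤ 1 := by
  have := norm_complexJ0_le t
  rw [complexJ0_ofReal, Complex.norm_real, Complex.ofReal_im] at this
  simpa using this.trans (besselI0_le_exp le_rfl)

/-! ### Power series of `I₀` -/

theorem integral_cos_pow_even (k : ℕ) : ∫ θ in (0 : ℝ)..Real.pi, Real.cos θ ^ (2 * k) =
    Real.pi * ((2 * k).factorial / (4 ^ k * (k.factorial : ℝ) ^ 2)) := by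
  induction k with
  | zero => simp
  | succ k ih =>
    rw [show 2 * (k + 1) = 2 * k + 2 by ring, integral_cos_pow, ih]
    simp only [Nat.factorial_succ, Real.sin_pi, Real.sin_zero]
    push_cast
    field_simp
    ring

theorem integral_cos_pow_odd (k : ℕ) : ∫ θ in (0 : ℝ)..Real.pi, Real.cos θ ^ (2 * k + 1) = 0 := by
  have := intervalIntegral.integral_comp_sub_left (a := 0) (b := Real.pi)
      (fun θ : ℝ => Real.cos θ ^ (2 * k + 1)) Real.pi
  simp only [Real.cos_pi_sub, sub_self, sub_zero, Odd.neg_pow (⟨k, rfl⟩ : Odd (2 * k + 1)),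
    intervalIntegral.integral_neg] at this
  linarith

/-- The exponential series is integrated termwise; odd moments of `cos` vanish and even ones are
Wallis integrals. -/
theorem hasSum_besselI0 (t : ℝ) :
    HasSum (fun k : ℕ => t ^ (2 * k) / (4 ^ k * (k.factorial : ℝ) ^ 2)) (besselI0 t) := by
  have hpi := Real.pi_pos
  have h : HasSum (fun n : ℕ => ∫ θ in (0 : ℝ)..Real.pi, (t * Real.cos θ) ^ n / n.factorial)
      (∫ θ in (0 : ℝ)..Real.pi, Real.exp (t * Real.cos θ)) := by
    refine intervalIntegral.hasSum_integral_of_dominated_convergence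
      (fun n _ => |t| ^ n / n.factorial) (fun n => Continuous.aestronglyMeasurable (by fun_prop))
      (fun n => Eventually.of_forall fun θ _ => ?_)
      (Eventually.of_forall fun θ _ => Real.summable_pow_div_factorial _) (by simp)
      (Eventually.of_forall fun θ _ => ?_)
    · rw [Real.norm_eq_abs, abs_div, abs_pow, Nat.abs_cast, abs_mul]
      gcongr
      exact mul_le_of_le_one_right (abs_nonneg _) (Real.abs_cos_le_one θ)
    · rw [Real.exp_eq_exp_ℝ]
      exact NormedSpace.expSeries_div_hasSum_exp _
  have h' := h.mul_left (1 / Real.pi)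
  have hinj : Function.Injective fun k : ℕ => 2 * k := fun a b hab => by simpa using hab
  rw [← hinj.hasSum_iff] at h'
  · refine h'.congr_fun fun k => ?_
    simp only [Function.comp, mul_pow, intervalIntegral.integral_div,
      intervalIntegral.integral_const_mul]
    rw [integral_cos_pow_even]
    field_simp
  · intro n hn
    rcases Nat.even_or_odd' n with ⟨k, rfl | rfl⟩
    · exact absurd ⟨k, rfl⟩ hn
    · simp only [mul_pow, intervalIntegral.integral_div,
        intervalIntegral.integral_const_mul, integral_cos_pow_odd]
      simp

/-! ### `K₀` on the closed right half plane -/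

/-- The integrand of the Laplace-type representation of `K₀`. -/
noncomputable def k0Kernel (w : ℂ) (s : ℝ) : ℂ :=
  Real.exp (-1 * s ^ 2) * ((s : ℂ) ^ 2 + 2 * w) ^ ((-(1 / 2) : ℝ) : ℂ)

/-- The Bessel function `K₀` on the closed right half plane. -/
noncomputable def complexK0 (w : ℂ) : ℂ :=
  2 * Complex.exp (-w) * ∫ s in Ioi (0 : ℝ), k0Kernel w s

theorem re_sq_add (w : ℂ) (s : ℝ) : ((s : ℂ) ^ 2 + 2 * w).re = s ^ 2 + 2 * w.re := by
  rw [← Complex.ofReal_pow, Complex.add_re, Complex.ofReal_re]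
  simp

theorem im_sq_add (w : ℂ) (s : ℝ) : ((s : ℂ) ^ 2 + 2 * w).im = 2 * w.im := by
  rw [← Complex.ofReal_pow, Complex.add_im, Complex.ofReal_im]
  simp

theorem sq_add_mem_slitPlane {w : ℂ} (hw : 0 ≤ w.re) {s : ℝ} (hs : 0 < s) :
    (s : ℂ) ^ 2 + 2 * w ∈ Complex.slitPlane := by
  left
  rw [re_sq_add]
  positivity

/-- Adding `s² ≥ 0` to a number with nonnegative real part cannot decrease its modulus. -/
theorem two_mul_norm_le_norm_sq_add {w : ℂ} (hw : 0 ≤ w.re) (s : ℝ) :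
    2 * ‖w‖ ≤ ‖(s : ℂ) ^ 2 + 2 * w‖ := by
  rw [← abs_of_nonneg (by positivity : 0 ≤ 2 * ‖w‖), ← abs_norm ((s : ℂ) ^ 2 + 2 * w),
    ← sq_le_sq, mul_pow, ← Complex.normSq_eq_norm_sq, ← Complex.normSq_eq_norm_sq,
    Complex.normSq_apply, Complex.normSq_apply, re_sq_add, im_sq_add]
  nlinarith [mul_nonneg (sq_nonneg s) hw, sq_nonneg (s ^ 2)]

theorem sq_le_norm_sq_add {w : ℂ} (hw : 0 ≤ w.re) (s : ℝ) :
    s ^ 2 ≤ ‖(s : ℂ) ^ 2 + 2 * w‖ := by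
  refine le_trans ?_ (Complex.re_le_norm _)
  rw [re_sq_add]
  linarith

theorem norm_k0Kernel (w : ℂ) (s : ℝ) :
    ‖k0Kernel w s‖ = Real.exp (-1 * s ^ 2) * ‖(s : ℂ) ^ 2 + 2 * w‖ ^ (-(1 / 2) : ℝ) := by
  rw [k0Kernel, norm_mul, Complex.norm_cpow_real, Complex.norm_real, Real.norm_eq_abs,
    abs_of_pos (Real.exp_pos _)]

/-- The free lower bound `c` lets a single dominating function serve a whole neighbourhood of `w`.
-/
theorem norm_k0Kernel_le {w : ℂ} (hw : 0 ≤ w.re) {c : ℝ} (hc : 0 < c) (hcw : c ≤ 2 * ‖w‖)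
    (s : ℝ) : ‖k0Kernel w s‖ ≤ Real.exp (-1 * s ^ 2) * c ^ (-(1 / 2) : ℝ) := by
  rw [norm_k0Kernel]
  exact mul_le_mul_of_nonneg_left (Real.rpow_le_rpow_of_nonpos hc
    (hcw.trans (two_mul_norm_le_norm_sq_add hw s)) (by norm_num)) (Real.exp_pos _).le

/-- The exponent `-1/2` is split as `-1/8 - 3/8`: the first part is spent on `‖w‖`, the second on
`s`, where `s^(-3/4)` is still integrable at `0`. The logarithmic singularity is thus replaced by
`‖w‖^(-1/8)`, weak enough that seven factors times `‖z‖` still tend to `0`. -/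
theorem norm_k0Kernel_le_rpow {w : ℂ} (hw : 0 ≤ w.re) (hw0 : w ≠ 0) {s : ℝ} (hs : 0 < s) :
    ‖k0Kernel w s‖ ≤
      (2 * ‖w‖) ^ (-(1 / 8) : ℝ) * (s ^ (-(3 / 4) : ℝ) * Real.exp (-1 * s ^ 2)) := by
  have hpos : 0 < ‖w‖ := norm_pos_iff.2 hw0
  have h1 := two_mul_norm_le_norm_sq_add hw s
  have h2 := sq_le_norm_sq_add hw s
  have h3 : 0 < ‖(s : ℂ) ^ 2 + 2 * w‖ := lt_of_lt_of_le (by positivity) h1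
  rw [norm_k0Kernel, show (-(1 / 2) : ℝ) = -(1 / 8) + -(3 / 8) by norm_num, Real.rpow_add h3]
  have h4 : s ^ (-(3 / 4) : ℝ) = (s ^ 2) ^ (-(3 / 8) : ℝ) := by
    rw [← Real.rpow_natCast s 2, ← Real.rpow_mul hs.le]; norm_num
  have h5 := Real.rpow_le_rpow_of_nonpos (by positivity : 0 < 2 * ‖w‖) h1
    (by norm_num : (-(1 / 8) : ℝ) ≤ 0)
  have h6 := Real.rpow_le_rpow_of_nonpos (by positivity : 0 < s ^ 2) h2
    (by norm_num : (-(3 / 8) : ℝ) ≤ 0)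
  rw [h4]
  calc _ ≤ Real.exp (-1 * s ^ 2) * ((2 * ‖w‖) ^ (-(1 / 8) : ℝ) * (s ^ 2) ^ (-(3 / 8) : ℝ)) := by
        gcongr
    _ = _ := by ring

theorem continuousOn_k0Kernel {w : ℂ} (hw : 0 ≤ w.re) : ContinuousOn (k0Kernel w) (Ioi 0) := by
  unfold k0Kernel
  refine ContinuousOn.mul (by fun_prop) (ContinuousOn.cpow_const (by fun_prop) fun s hs => ?_)
  exact sq_add_mem_slitPlane hw hs

theorem aestronglyMeasurable_k0Kernel {w : ℂ} (hw : 0 ≤ w.re) :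
    AEStronglyMeasurable (k0Kernel w) (volume.restrict (Ioi 0)) :=
  (continuousOn_k0Kernel hw).aestronglyMeasurable measurableSet_Ioi

theorem integrableOn_gaussian_mul (c : ℝ) :
    IntegrableOn (fun s : ℝ => Real.exp (-1 * s ^ 2) * c) (Ioi 0) :=
  ((integrable_exp_neg_mul_sq one_pos).mul_const c).integrableOn

theorem integrableOn_k0Kernel {w : ℂ} (hw : 0 ≤ w.re) (hw0 : w ≠ 0) :
    IntegrableOn (k0Kernel w) (Ioi 0) :=
  Integrable.mono' (integrableOn_gaussian_mul _) (aestronglyMeasurable_k0Kernel hw)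
    (Eventually.of_forall (norm_k0Kernel_le hw (by positivity) le_rfl))

theorem norm_complexK0_le {w : ℂ} (hw : 0 ≤ w.re) (hw0 : w ≠ 0) :
    ‖complexK0 w‖ ≤ 2 * Real.exp (-w.re) * ‖w‖ ^ (-(1 / 2) : ℝ) := by
  have hpos : 0 < ‖w‖ := norm_pos_iff.2 hw0
  have h : ‖∫ s in Ioi (0 : ℝ), k0Kernel w s‖ ≤
      ∫ s in Ioi (0 : ℝ), Real.exp (-1 * s ^ 2) * ‖w‖ ^ (-(1 / 2) : ℝ) :=
    norm_integral_le_of_norm_le (integrableOn_gaussian_mul _)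
      (Eventually.of_forall (norm_k0Kernel_le hw hpos (by linarith)))
  rw [integral_mul_const, integral_gaussian_Ioi] at h
  have h2 : √(Real.pi / 1) / 2 ≤ 1 := by
    have : √(Real.pi / 1) ≤ 2 := Real.sqrt_le_iff.2 ⟨by norm_num, by linarith [Real.pi_le_four]⟩
    linarith
  rw [complexK0, norm_mul, norm_mul, Complex.norm_exp, Complex.neg_re, Complex.norm_two]
  gcongr
  exact h.trans (mul_le_of_le_one_left (by positivity) h2)

theorem exists_norm_complexK0_le_rpow : ∃ C : ℝ, 0 ≤ C ∧ ∀ w : ℂ, 0 ≤ w.re → w ≠ 0 →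
    ‖complexK0 w‖ ≤ C * ‖w‖ ^ (-(1 / 8) : ℝ) := by
  have hint := integrableOn_rpow_mul_exp_neg_mul_sq one_pos (by norm_num : (-1 : ℝ) < -(3 / 4))
  set A := ∫ s in Ioi (0 : ℝ), s ^ (-(3 / 4) : ℝ) * Real.exp (-1 * s ^ 2) with hA
  have hA0 : 0 ≤ A := setIntegral_nonneg measurableSet_Ioi fun s hs =>
    mul_nonneg (Real.rpow_nonneg (le_of_lt hs) _) (Real.exp_pos _).le
  refine ⟨2 * A, by positivity, fun w hw hw0 => ?_⟩
  have hpos : 0 < ‖w‖ := norm_pos_iff.2 hw0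
  have h : ‖∫ s in Ioi (0 : ℝ), k0Kernel w s‖ ≤ (2 * ‖w‖) ^ (-(1 / 8) : ℝ) * A := by
    rw [hA, ← integral_const_mul]
    refine norm_integral_le_of_norm_le (hint.const_mul _) ?_
    filter_upwards [ae_restrict_mem measurableSet_Ioi] with s hs
      using norm_k0Kernel_le_rpow hw hw0 hs
  have h1 : (2 * ‖w‖) ^ (-(1 / 8) : ℝ) ≤ ‖w‖ ^ (-(1 / 8) : ℝ) :=
    Real.rpow_le_rpow_of_nonpos hpos (by linarith) (by norm_num)
  rw [complexK0, norm_mul, norm_mul, Complex.norm_exp, Complex.neg_re, Complex.norm_two]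
  have h2 : Real.exp (-w.re) ≤ 1 := Real.exp_le_one_iff.2 (by linarith)
  calc _ ≤ 2 * 1 * (‖w‖ ^ (-(1 / 8) : ℝ) * A) := by
        gcongr; exact h.trans (by gcongr)
    _ = _ := by ring

/-- Continuity up to the imaginary axis is needed because that axis carries the boundary values of
the Hankel function on the real line. -/
theorem continuousOn_complexK0 : ContinuousOn complexK0 {w | 0 ≤ w.re ∧ w ≠ 0} := by
  intro w₀ hw₀
  have hpos : 0 < ‖w₀‖ := norm_pos_iff.2 hw₀.2
  refine ContinuousWithinAt.mul (by fun_prop) ?_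
  have hev : ∀ᶠ w in 𝓝[{w : ℂ | 0 ≤ w.re ∧ w ≠ 0}] w₀, ‖w₀‖ / 2 < ‖w‖ ∧ 0 ≤ w.re := by
    filter_upwards [self_mem_nhdsWithin, nhdsWithin_le_nhds
      (continuous_norm.continuousAt.eventually (lt_mem_nhds (half_lt_self hpos)))] with w hw hw'
      using ⟨hw', hw.1⟩
  refine continuousWithinAt_of_dominated
    (bound := fun s => Real.exp (-1 * s ^ 2) * ‖w₀‖ ^ (-(1 / 2) : ℝ)) ?_ ?_
    (integrableOn_gaussian_mul _) ?_
  · filter_upwards [hev] with w hw using aestronglyMeasurable_k0Kernel hw.2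
  · filter_upwards [hev] with w hw
    exact Eventually.of_forall (norm_k0Kernel_le hw.2 hpos (by linarith))
  · filter_upwards [ae_restrict_mem measurableSet_Ioi] with s hs
    unfold k0Kernel
    refine ContinuousWithinAt.mul (by fun_prop) (ContinuousWithinAt.cpow (by fun_prop)
      (by fun_prop) (sq_add_mem_slitPlane hw₀.1 hs))

theorem differentiableAt_complexK0 {w₀ : ℂ} (hw₀ : 0 < w₀.re) : DifferentiableAt ℂ complexK0 w₀ := by
  refine DifferentiableAt.mul (by fun_prop) ?_
  have hs : {w : ℂ | w₀.re / 2 < w.re} ∈ 𝓝 w₀ :=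
    Complex.continuous_re.continuousAt.eventually (lt_mem_nhds (by linarith))
  have h0 : w₀ ≠ 0 := by rintro rfl; simp at hw₀
  refine (hasDerivAt_integral_of_dominated_loc_of_deriv_le (F := k0Kernel)
    (F' := fun w s => Real.exp (-1 * s ^ 2) *
      (((-(1 / 2) : ℝ) : ℂ) * ((s : ℂ) ^ 2 + 2 * w) ^ (((-(1 / 2) : ℝ) : ℂ) - 1) * 2))
    (bound := fun s => Real.exp (-1 * s ^ 2) * w₀.re ^ (-(3 / 2) : ℝ)) hs ?_
    (integrableOn_k0Kernel hw₀.le h0) ?_ ?_ (integrableOn_gaussian_mul _) ?_).2.differentiableAt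
  · filter_upwards [hs] with w hw
    exact aestronglyMeasurable_k0Kernel (by have : w₀.re / 2 < w.re := hw; linarith)
  · refine ContinuousOn.aestronglyMeasurable ?_ measurableSet_Ioi
    refine ContinuousOn.mul (by fun_prop) (ContinuousOn.mul (ContinuousOn.mul (by fun_prop)
      (ContinuousOn.cpow_const (by fun_prop) fun s hs => ?_)) (by fun_prop))
    exact sq_add_mem_slitPlane hw₀.le hs
  · refine Eventually.of_forall fun s w hw => ?_
    have hw : w₀.re / 2 < w.re := hw
    have h1 := two_mul_norm_le_norm_sq_add (by linarith : 0 ≤ w.re) s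
    have h2 := Complex.re_le_norm w
    rw [show ((-(1 / 2) : ℝ) : ℂ) - 1 = ((-(3 / 2) : ℝ) : ℂ) by push_cast; ring, norm_mul, norm_mul,
      norm_mul, Complex.norm_cpow_real, Complex.norm_real, Complex.norm_real, Real.norm_eq_abs,
      abs_of_pos (Real.exp_pos _), Complex.norm_two]
    have h3 := Real.rpow_le_rpow_of_nonpos hw₀ (by linarith : w₀.re ≤ ‖(s : ℂ) ^ 2 + 2 * w‖)
      (by norm_num : (-(3 / 2) : ℝ) ≤ 0)
    gcongr
    norm_num at h3 ⊢
    linarith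
  · filter_upwards [ae_restrict_mem measurableSet_Ioi] with s hs w hw
    have hw : w₀.re / 2 < w.re := hw
    refine HasDerivAt.const_mul _ (HasDerivAt.cpow_const ?_
      (sq_add_mem_slitPlane (by linarith) hs))
    simpa using ((hasDerivAt_id w).const_mul 2).const_add ((s : ℂ) ^ 2)

theorem image_sinh_half {t : ℝ} (ht : 0 < t) :
    (fun u : ℝ => √(2 * t) * Real.sinh (u / 2)) '' Ioi 0 = Ioi 0 := by
  have hq : 0 < √(2 * t) := Real.sqrt_pos.2 (by linarith)
  ext s
  constructor
  · rintro ⟨u, hu, rfl⟩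
    have hu : 0 < u := hu
    exact mul_pos hq (Real.sinh_pos_iff.2 (by linarith))
  · intro hs
    have hs : 0 < s := hs
    refine ⟨2 * Real.arsinh (s / √(2 * t)), ?_, ?_⟩
    · have := Real.arsinh_pos_iff.2 (div_pos hs hq)
      rw [mem_Ioi]; linarith
    · simp only []
      rw [mul_div_cancel_left₀ _ two_ne_zero, Real.sinh_arsinh]
      field_simp

/-- Substitute `s = √(2t) sinh(u/2)`: since `cosh u = 1 + 2 sinh²(u/2)`, one has `t + s² = t cosh
u`, and the Jacobian cancels the square root. -/
theorem complexK0_ofReal {t : ℝ} (ht : 0 < t) : complexK0 t = besselK0 t := by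
  have hq : 0 < √(2 * t) := Real.sqrt_pos.2 (by linarith)
  have hq2 : √(2 * t) ^ 2 = 2 * t := Real.sq_sqrt (by linarith)
  have h1 : ∀ s ∈ Ioi (0 : ℝ), k0Kernel t s =
      ((Real.exp (-1 * s ^ 2) * (s ^ 2 + 2 * t) ^ (-(1 / 2) : ℝ) : ℝ) : ℂ) := by
    intro s _
    rw [k0Kernel, Complex.ofReal_mul, Complex.ofReal_cpow (by positivity)]
    push_cast
    rfl
  have h2 := integral_image_eq_integral_abs_deriv_smul (s := Ioi 0)
    (f := fun u : ℝ => √(2 * t) * Real.sinh (u / 2))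
    (f' := fun u => √(2 * t) * (Real.cosh (u / 2) * (1 / 2))) measurableSet_Ioi
    (fun u _ => (((Real.hasDerivAt_sinh (u / 2)).comp u
      ((hasDerivAt_id u).div_const 2)).const_mul _).hasDerivWithinAt)
    (fun u _ v _ huv => by
      have := Real.sinh_injective (mul_left_cancel₀ hq.ne' huv)
      linarith)
    (fun s => Real.exp (-1 * s ^ 2) * (s ^ 2 + 2 * t) ^ (-(1 / 2) : ℝ))
  rw [image_sinh_half ht] at h2
  have h3 : ∀ u : ℝ, |√(2 * t) * (Real.cosh (u / 2) * (1 / 2))| •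
      (Real.exp (-1 * (√(2 * t) * Real.sinh (u / 2)) ^ 2) *
        ((√(2 * t) * Real.sinh (u / 2)) ^ 2 + 2 * t) ^ (-(1 / 2) : ℝ)) =
      1 / 2 * Real.exp t * Real.exp (-t * Real.cosh u) := by
    intro u
    have hc := Real.cosh_pos (u / 2)
    have hcs := Real.cosh_sq (u / 2)
    have e1 : (√(2 * t) * Real.sinh (u / 2)) ^ 2 + 2 * t = (√(2 * t) * Real.cosh (u / 2)) ^ 2 := by
      rw [mul_pow, mul_pow, hq2, hcs]; ring
    have e2 : Real.cosh u = 1 + 2 * Real.sinh (u / 2) ^ 2 := by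
      have := Real.cosh_two_mul (u / 2)
      rw [mul_div_cancel₀ u two_ne_zero] at this
      rw [this, hcs]; ring
    rw [e1, Real.rpow_neg (by positivity), ← Real.sqrt_eq_rpow, Real.sqrt_sq (by positivity),
      abs_of_pos (by positivity), smul_eq_mul, mul_assoc (1 / 2 : ℝ), ← Real.exp_add, mul_pow, hq2,
      e2, show -1 * (2 * t * Real.sinh (u / 2) ^ 2) = t + -t * (1 + 2 * Real.sinh (u / 2) ^ 2) by
        ring]
    field_simp
  simp only [h3] at h2
  rw [integral_const_mul] at h2
  rw [complexK0, setIntegral_congr_fun measurableSet_Ioi h1, integral_complex_ofReal, h2]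
  rw [besselK0, ← Complex.ofReal_neg, ← Complex.ofReal_exp]
  norm_cast
  rw [show ∀ K : ℝ, 2 * Real.exp (-t) * (1 / 2 * Real.exp t * K) =
    Real.exp (-t) * Real.exp t * K by intro K; ring, ← Real.exp_add]
  simp

theorem besselK0_nonneg (t : ℝ) : 0 ≤ besselK0 t :=
  setIntegral_nonneg measurableSet_Ioi fun _ _ => (Real.exp_pos _).le

theorem besselK0_eq_norm {t : ℝ} (ht : 0 < t) : besselK0 t = ‖complexK0 t‖ := by
  rw [complexK0_ofReal ht, Complex.norm_real, Real.norm_eq_abs, abs_of_nonneg (besselK0_nonneg t)]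

theorem besselK0_le {t : ℝ} (ht : 0 < t) :
    besselK0 t ≤ 2 * Real.exp (-t) * t ^ (-(1 / 2) : ℝ) := by
  have := norm_complexK0_le (w := t) (by simpa using ht.le) (by simpa using ht.ne')
  rwa [← besselK0_eq_norm ht, Complex.ofReal_re, Complex.norm_real, Real.norm_eq_abs,
    abs_of_pos ht] at this

theorem exists_besselK0_le_rpow :
    ∃ C : ℝ, 0 ≤ C ∧ ∀ t : ℝ, 0 < t → besselK0 t ≤ C * t ^ (-(1 / 8) : ℝ) := by
  obtain ⟨C, hC, h⟩ := exists_norm_complexK0_le_rpow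
  refine ⟨C, hC, fun t ht => ?_⟩
  have := h t (by simpa using ht.le) (by simpa using ht.ne')
  rwa [← besselK0_eq_norm ht, Complex.norm_real, Real.norm_eq_abs, abs_of_pos ht] at this

theorem continuousOn_besselK0 : ContinuousOn besselK0 (Ioi 0) := by
  have : ContinuousOn (fun t : ℝ => (complexK0 t).re) (Ioi 0) := by
    refine Complex.continuous_re.comp_continuousOn
      (continuousOn_complexK0.comp (by fun_prop) fun t ht => ?_)
    have ht : 0 < t := ht
    simp [ht.le, ht.ne']
  refine this.congr fun t ht => ?_
  simp [complexK0_ofReal ht]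

/-! ### `J₀` as the imaginary part of `K₀` on the imaginary axis -/

/-- The integrand common to the Poisson and Mehler–Sonine integrals. -/
noncomputable def stripKernel (t : ℝ) (z : ℂ) : ℂ :=
  Complex.exp (Complex.I * t * z) * (1 - z ^ 2) ^ ((-(1 / 2) : ℝ) : ℂ)

theorem one_sub_sq_mem_slitPlane {z : ℂ} (h0 : 0 ≤ z.re) (h1 : z.re ≤ 1)
    (h : z.re < 1 ∨ 0 < z.im) : 1 - z ^ 2 ∈ Complex.slitPlane := by
  left
  have : (1 - z ^ 2).re = 1 - z.re ^ 2 + z.im ^ 2 := by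
    rw [pow_two z, Complex.sub_re, Complex.mul_re, Complex.one_re]; ring
  rw [this]
  rcases h with h | h
  · nlinarith [sq_nonneg z.im]
  · nlinarith [sq_pos_of_pos h]

/-- `1 - z² = (1 - z)(1 + z)` with factors of modulus at least `y` and `1`. The bound does not
involve `r`, which permits both truncation at infinity and the limit `r → 1`. -/
theorem norm_stripKernel_le (t : ℝ) {r y : ℝ} (h0 : 0 ≤ r) (hy : 0 < y) :
    ‖stripKernel t (r + y * Complex.I)‖ ≤ y ^ (-(1 / 2) : ℝ) * Real.exp (-t * y) := by
  set z : ℂ := r + y * Complex.I with hz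
  have hre : z.re = r := by simp [hz]
  have him : z.im = y := by simp [hz]
  have h1 : y ≤ ‖1 - z‖ := by
    have := Complex.abs_im_le_norm (1 - z)
    rwa [Complex.sub_im, Complex.one_im, him, zero_sub, abs_neg, abs_of_pos hy] at this
  have h2 : 1 ≤ ‖1 + z‖ := by
    have := Complex.re_le_norm (1 + z)
    rw [Complex.add_re, Complex.one_re, hre] at this
    linarith
  have h3 : y ≤ ‖1 - z ^ 2‖ := by
    rw [show 1 - z ^ 2 = (1 - z) * (1 + z) by ring, norm_mul]
    nlinarith [norm_nonneg (1 - z)]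
  have h4 : (Complex.I * t * z).re = -t * y := by
    simp [hz]
  rw [stripKernel, norm_mul, Complex.norm_exp, h4, Complex.norm_cpow_real, mul_comm]
  exact mul_le_mul_of_nonneg_right (Real.rpow_le_rpow_of_nonpos hy h3 (by norm_num))
    (Real.exp_pos _).le

theorem continuousAt_stripKernel (t : ℝ) {z : ℂ} (h0 : 0 ≤ z.re) (h1 : z.re ≤ 1)
    (h : z.re < 1 ∨ 0 < z.im) : ContinuousAt (stripKernel t) z := by
  unfold stripKernel
  exact ContinuousAt.mul (by fun_prop) (ContinuousAt.cpow (by fun_prop) (by fun_prop)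
    (one_sub_sq_mem_slitPlane h0 h1 h))

theorem differentiableAt_stripKernel (t : ℝ) {z : ℂ} (h0 : 0 ≤ z.re) (h1 : z.re < 1) :
    DifferentiableAt ℂ (stripKernel t) z := by
  unfold stripKernel
  exact DifferentiableAt.mul (by fun_prop) (DifferentiableAt.cpow (by fun_prop) (by fun_prop)
    (one_sub_sq_mem_slitPlane h0 h1.le (Or.inl h1)))

theorem continuousOn_stripKernel_vertical (t : ℝ) {r : ℝ} (h0 : 0 ≤ r) (h1 : r ≤ 1) :
    ContinuousOn (fun y : ℝ => stripKernel t (r + y * Complex.I)) (Ioi 0) := by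
  intro y hy
  refine ContinuousAt.continuousWithinAt (ContinuousAt.comp (f := fun y : ℝ => r + y * Complex.I)
    (continuousAt_stripKernel t ?_ ?_ ?_) (by fun_prop)) <;> simp [h0, h1, show 0 < y from hy]

theorem integrableOn_stripBound {t : ℝ} (ht : 0 < t) :
    IntegrableOn (fun y : ℝ => y ^ (-(1 / 2) : ℝ) * Real.exp (-t * y)) (Ioi 0) := by
  simpa using integrableOn_rpow_mul_exp_neg_mul_rpow (s := -(1 / 2)) (p := 1) (by norm_num)
    one_pos ht

theorem integrableOn_stripKernel_vertical {t : ℝ} (ht : 0 < t) {r : ℝ} (h0 : 0 ≤ r) (h1 : r ≤ 1) :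
    IntegrableOn (fun y : ℝ => stripKernel t (r + y * Complex.I)) (Ioi 0) := by
  refine Integrable.mono' (integrableOn_stripBound ht)
    ((continuousOn_stripKernel_vertical t h0 h1).aestronglyMeasurable measurableSet_Ioi) ?_
  filter_upwards [ae_restrict_mem measurableSet_Ioi] with y hy using norm_stripKernel_le t h0 hy

theorem stripKernel_ofReal_re (t : ℝ) {x : ℝ} (h0 : 0 ≤ x) (h1 : x < 1) :
    (stripKernel t x).re = Real.cos (t * x) * (1 - x ^ 2) ^ (-(1 / 2) : ℝ) := by
  have h : (0 : ℝ) ≤ 1 - x ^ 2 := by nlinarith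
  have : ((1 - (x : ℂ) ^ 2)) ^ ((-(1 / 2) : ℝ) : ℂ) = (((1 - x ^ 2) ^ (-(1 / 2) : ℝ) : ℝ) : ℂ) := by
    rw [Complex.ofReal_cpow h]; push_cast; rfl
  rw [stripKernel, this, Complex.re_mul_ofReal,
    show Complex.I * t * x = ((t * x : ℝ) : ℂ) * Complex.I by push_cast; ring,
    Complex.exp_ofReal_mul_I_re]

/-- With `dz = i dy`, the left side of the strip therefore contributes nothing to the real part. -/
theorem stripKernel_mul_I_im (t y : ℝ) : (stripKernel t (y * Complex.I)).im = 0 := by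
  have h : (0 : ℝ) ≤ 1 + y ^ 2 := by positivity
  have : (1 - (y * Complex.I) ^ 2) ^ ((-(1 / 2) : ℝ) : ℂ) =
      (((1 + y ^ 2) ^ (-(1 / 2) : ℝ) : ℝ) : ℂ) := by
    rw [Complex.ofReal_cpow h, mul_pow, Complex.I_sq]; push_cast; ring_nf
  rw [stripKernel, this, Complex.im_mul_ofReal,
    show Complex.I * t * (y * Complex.I) = ((-(t * y) : ℝ) : ℂ) by
      rw [show Complex.I * t * (y * Complex.I) = Complex.I * Complex.I * (t * y) by ring,
        Complex.I_mul_I]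
      push_cast; ring,
    ← Complex.ofReal_exp, Complex.ofReal_im, zero_mul]

/-- Taking `r < 1` keeps the rectangle away from the branch point at `1`. -/
theorem stripKernel_rect (t : ℝ) {r Y : ℝ} (h0 : 0 < r) (h1 : r < 1) (hY : 0 < Y) :
    (∫ x in (0 : ℝ)..r, stripKernel t x) - (∫ x in (0 : ℝ)..r, stripKernel t (x + Y * Complex.I)) +
      Complex.I * (∫ y in (0 : ℝ)..Y, stripKernel t (r + y * Complex.I)) -
      Complex.I * (∫ y in (0 : ℝ)..Y, stripKernel t (y * Complex.I)) = 0 := by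
  have h := Complex.integral_boundary_rect_eq_zero_of_differentiableOn (stripKernel t) 0
    (r + Y * Complex.I) (fun z hz => by
      simp only [Complex.zero_re, Complex.zero_im, Complex.add_re, Complex.add_im,
        Complex.ofReal_re, Complex.ofReal_im, Complex.re_ofReal_mul, Complex.im_ofReal_mul,
        Complex.I_re, Complex.I_im, mul_zero, mul_one, add_zero, zero_add,
        uIcc_of_le h0.le, uIcc_of_le hY.le, Complex.mem_reProdIm] at hz
      exact (differentiableAt_stripKernel t hz.1.1
        (hz.1.2.trans_lt h1)).differentiableWithinAt)
  simpa using h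

theorem integral_stripKernel_re {t : ℝ} (ht : 0 < t) {r : ℝ} (h0 : 0 < r) (h1 : r < 1) :
    (∫ x in (0 : ℝ)..r, stripKernel t x).re =
      (∫ y in Ioi (0 : ℝ), stripKernel t (r + y * Complex.I)).im := by
  have hright := (Complex.continuous_im.tendsto _).comp (intervalIntegral_tendsto_integral_Ioi 0
    (integrableOn_stripKernel_vertical ht h0.le h1.le) tendsto_id)
  have htop : Tendsto (fun Y : ℝ => ∫ x in (0 : ℝ)..r, stripKernel t (x + Y * Complex.I)) atTop
      (𝓝 0) := by
    have hb : Tendsto (fun Y : ℝ => Y ^ (-(1 / 2) : ℝ) * |r - 0|) atTop (𝓝 0) := by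
      simpa using (tendsto_rpow_neg_atTop (by norm_num : (0 : ℝ) < 1 / 2)).mul_const |r - 0|
    refine squeeze_zero_norm' ?_ hb
    filter_upwards [eventually_gt_atTop 0] with Y hY
    refine intervalIntegral.norm_integral_le_of_norm_le_const fun x hx => ?_
    rw [uIoc_of_le h0.le] at hx
    refine (norm_stripKernel_le t hx.1.le hY).trans (mul_le_of_le_one_right (by positivity) ?_)
    exact Real.exp_le_one_iff.2 (by nlinarith)
  have htop' := (Complex.continuous_re.tendsto _).comp htop
  have hsum := htop'.add hright
  rw [Complex.zero_re, zero_add] at hsum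
  refine tendsto_nhds_unique (tendsto_const_nhds.congr' ?_) hsum
  filter_upwards [eventually_gt_atTop 0] with Y hY
  have h := congrArg Complex.re (stripKernel_rect t h0 h1 hY)
  have hleft : (∫ y in (0 : ℝ)..Y, stripKernel t (y * Complex.I)).im = 0 := by
    have hc : IntervalIntegrable (fun y : ℝ => stripKernel t (y * Complex.I)) volume 0 Y := by
      refine Continuous.intervalIntegrable (continuous_iff_continuousAt.2 fun y => ?_) _ _
      refine ContinuousAt.comp (f := fun y : ℝ => y * Complex.I)
        (continuousAt_stripKernel t ?_ ?_ ?_) (by fun_prop) <;> simp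
    rw [← Complex.imCLM_apply, ← Complex.imCLM.intervalIntegral_comp_comm hc]
    simp [stripKernel_mul_I_im]
  simp only [Complex.sub_re, Complex.add_re, Complex.mul_re, Complex.I_re, Complex.I_im, hleft,
    Complex.zero_re] at h
  simp only [Function.comp, id]
  linarith

/-- The substitution `x = sin a` absorbs the weight `(1 - x²)^(-1/2)`, so the limit `r → 1` meets no
singularity on this side. -/
theorem integral_stripKernel_re_eq_arcsin (t : ℝ) {r : ℝ} (h0 : 0 < r) (h1 : r < 1) :
    (∫ x in (0 : ℝ)..r, stripKernel t x).re =
      ∫ a in (0 : ℝ)..Real.arcsin r, Real.cos (t * Real.sin a) := by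
  have hc : ContinuousOn (fun x : ℝ => stripKernel t x) (uIcc 0 r) := by
    intro x hx
    rw [uIcc_of_le h0.le] at hx
    exact (ContinuousAt.comp (f := fun y : ℝ => (y : ℂ)) (continuousAt_stripKernel t (by simpa using hx.1)
      (by simpa using hx.2.trans h1.le) (Or.inl (by simpa using hx.2.trans_lt h1)))
      (by fun_prop)).continuousWithinAt
  have hcr := Complex.continuous_re.comp_continuousOn hc
  rw [← Complex.reCLM_apply, ← Complex.reCLM.intervalIntegral_comp_comm hc.intervalIntegrable]
  simp only [Complex.reCLM_apply]
  have hpi := Real.pi_pos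
  have ha0 : 0 ≤ Real.arcsin r := Real.arcsin_nonneg.2 h0.le
  have ha1 : Real.arcsin r < Real.pi / 2 := Real.arcsin_lt_pi_div_two.2 h1
  have himg : Real.sin '' uIcc 0 (Real.arcsin r) ⊆ uIcc 0 r := by
    rintro _ ⟨a, ha, rfl⟩
    rw [uIcc_of_le ha0] at ha
    rw [uIcc_of_le h0.le]
    refine ⟨Real.sin_nonneg_of_nonneg_of_le_pi ha.1 (by linarith [ha.2]), ?_⟩
    rw [← Real.sin_arcsin (by linarith : -1 ≤ r) h1.le]
    exact Real.sin_le_sin_of_le_of_le_pi_div_two (by linarith [ha.1]) ha1.le ha.2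
  have h := intervalIntegral.integral_comp_mul_deriv'' (a := 0) (b := Real.arcsin r)
    (f := Real.sin) (f' := Real.cos) (g := fun x : ℝ => (stripKernel t x).re) (by fun_prop)
    (fun a _ => (Real.hasDerivAt_sin a).hasDerivWithinAt) (by fun_prop) (hcr.mono himg)
  rw [Real.sin_zero, Real.sin_arcsin (by linarith) h1.le] at h
  rw [← h]
  refine intervalIntegral.integral_congr fun a ha => ?_
  rw [uIcc_of_le ha0] at ha
  have hcos : 0 < Real.cos a := Real.cos_pos_of_mem_Ioo ⟨by linarith [ha.1], by linarith [ha.2]⟩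
  have hs := himg ⟨a, by rwa [uIcc_of_le ha0], rfl⟩
  rw [uIcc_of_le h0.le] at hs
  simp only [Function.comp]
  rw [stripKernel_ofReal_re t hs.1 (hs.2.trans_lt h1), ← Real.cos_sq', Real.rpow_neg (sq_nonneg _),
    ← Real.sqrt_eq_rpow, Real.sqrt_sq hcos.le]
  field_simp

theorem besselJ0_eq_sin (t : ℝ) :
    Real.pi / 2 * besselJ0 t = ∫ a in (0 : ℝ)..(Real.pi / 2), Real.cos (t * Real.sin a) := by
  have := intervalIntegral.integral_comp_sub_left (a := 0) (b := Real.pi / 2)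
    (fun θ : ℝ => Real.cos (t * Real.cos θ)) (Real.pi / 2)
  simp only [Real.cos_pi_div_two_sub, sub_self, sub_zero] at this
  rw [this, besselJ0]
  field_simp

theorem besselJ0_eq_integral_stripKernel {t : ℝ} (ht : 0 < t) :
    Real.pi / 2 * besselJ0 t = (∫ y in Ioi (0 : ℝ), stripKernel t (1 + y * Complex.I)).im := by
  have hL : Tendsto (fun r => ∫ a in (0 : ℝ)..Real.arcsin r, Real.cos (t * Real.sin a)) (𝓝[<] 1)
      (𝓝 (Real.pi / 2 * besselJ0 t)) := by
    rw [besselJ0_eq_sin, ← Real.arcsin_one]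
    have hc : Continuous fun r : ℝ => ∫ a in (0 : ℝ)..r, Real.cos (t * Real.sin a) :=
      intervalIntegral.continuous_primitive
        (fun _ _ => Continuous.intervalIntegrable (by fun_prop) _ _) _
    exact ((hc.comp Real.continuous_arcsin).tendsto 1).mono_left nhdsWithin_le_nhds
  have hR : Tendsto (fun r : ℝ => (∫ y in Ioi (0 : ℝ), stripKernel t (r + y * Complex.I)).im)
      (𝓝[<] 1) (𝓝 (∫ y in Ioi (0 : ℝ), stripKernel t (1 + y * Complex.I)).im) := by
    refine (Complex.continuous_im.tendsto _).comp ?_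
    have hev : ∀ᶠ r : ℝ in 𝓝[<] 1, 0 ≤ r ∧ r ≤ 1 := by
      filter_upwards [Ioo_mem_nhdsLT (zero_lt_one' ℝ)] with r hr using ⟨hr.1.le, hr.2.le⟩
    refine tendsto_integral_filter_of_dominated_convergence _ ?_ ?_ (integrableOn_stripBound ht) ?_
    · filter_upwards [hev] with r hr
      exact (continuousOn_stripKernel_vertical t hr.1 hr.2).aestronglyMeasurable measurableSet_Ioi
    · filter_upwards [hev] with r hr
      filter_upwards [ae_restrict_mem measurableSet_Ioi] with y hy
        using norm_stripKernel_le t hr.1 hy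
    · filter_upwards [ae_restrict_mem measurableSet_Ioi] with y hy
      have hc : ContinuousAt (fun r : ℝ => stripKernel t (r + y * Complex.I)) 1 := by
        refine ContinuousAt.comp (f := fun r : ℝ => r + y * Complex.I)
          (continuousAt_stripKernel t ?_ ?_ ?_) (by fun_prop) <;> simp [show 0 < y from hy]
      simpa using hc.tendsto.mono_left nhdsWithin_le_nhds
  refine tendsto_nhds_unique (hL.congr' ?_) hR
  filter_upwards [Ioo_mem_nhdsLT (zero_lt_one' ℝ)] with r hr
  rw [← integral_stripKernel_re_eq_arcsin t hr.1 hr.2, integral_stripKernel_re ht hr.1 hr.2]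

theorem ofReal_mul_cpow {a : ℝ} (ha : 0 < a) {z : ℂ} (hz : z ≠ 0) (c : ℂ) :
    ((a : ℂ) * z) ^ c = (a : ℂ) ^ c * z ^ c := by
  have ha' : (a : ℂ) ≠ 0 := by exact_mod_cast ha.ne'
  rw [Complex.cpow_def_of_ne_zero (mul_ne_zero ha' hz), Complex.cpow_def_of_ne_zero ha',
    Complex.cpow_def_of_ne_zero hz, Complex.log_ofReal_mul ha hz, ← Complex.exp_add,
    Complex.ofReal_log ha.le]
  ring_nf

theorem image_sq_div {t : ℝ} (ht : 0 < t) : (fun s : ℝ => s ^ 2 / t) '' Ioi 0 = Ioi 0 := by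
  ext y
  constructor
  · rintro ⟨s, hs, rfl⟩
    have hs : 0 < s := hs
    rw [mem_Ioi]; positivity
  · intro hy
    have hy : 0 < y := hy
    refine ⟨√(t * y), Real.sqrt_pos.2 (by positivity), ?_⟩
    simp only []
    rw [Real.sq_sqrt (by positivity)]
    field_simp

/-- Substitute `y = s²/t`, which turns the exponential decay in `y` into the Gaussian of `k0Kernel`.
-/
theorem integral_stripKernel_one {t : ℝ} (ht : 0 < t) :
    ∫ y in Ioi (0 : ℝ), stripKernel t (1 + y * Complex.I) = complexK0 (-Complex.I * t) := by
  have ht' : (t : ℂ) ≠ 0 := by exact_mod_cast ht.ne'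
  have h := integral_image_eq_integral_abs_deriv_smul (s := Ioi 0)
    (f := fun s : ℝ => s ^ 2 / t) (f' := fun s => 2 * s / t) measurableSet_Ioi
    (fun s _ => by simpa using ((hasDerivAt_pow 2 s).div_const t).hasDerivWithinAt)
    (fun u hu v hv huv => by
      have h1 : u ^ 2 / t = v ^ 2 / t := huv
      rw [div_left_inj' ht.ne'] at h1
      exact (pow_left_inj₀ (le_of_lt hu) (le_of_lt hv) two_ne_zero).1 h1)
    (fun y : ℝ => stripKernel t (1 + y * Complex.I))
  rw [image_sq_div ht] at h
  rw [h, complexK0, ← integral_const_mul]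
  refine setIntegral_congr_fun measurableSet_Ioi fun s hs => ?_
  have hs : 0 < s := hs
  have hs' : (s : ℂ) ≠ 0 := by exact_mod_cast hs.ne'
  have hne : (s : ℂ) ^ 2 + 2 * (-Complex.I * t) ≠ 0 :=
    Complex.slitPlane_ne_zero (sq_add_mem_slitPlane (by simp) hs)
  have e1 : (1 : ℂ) - (1 + ((s ^ 2 / t : ℝ) : ℂ) * Complex.I) ^ 2 =
      (((s / t) ^ 2 : ℝ) : ℂ) * ((s : ℂ) ^ 2 + 2 * (-Complex.I * t)) := by
    push_cast
    field_simp
    linear_combination (-(s : ℂ) ^ 4) * Complex.I_sq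
  have e2 : (((s / t) ^ 2 : ℝ) : ℂ) ^ ((-(1 / 2) : ℝ) : ℂ) = ((t / s : ℝ) : ℂ) := by
    rw [← Complex.ofReal_cpow (sq_nonneg _), Real.rpow_neg (sq_nonneg _), ← Real.sqrt_eq_rpow,
      Real.sqrt_sq (by positivity), inv_div]
  have e3 : Complex.I * t * (1 + ((s ^ 2 / t : ℝ) : ℂ) * Complex.I) =
      -(-Complex.I * t) + ((-1 * s ^ 2 : ℝ) : ℂ) := by
    push_cast
    field_simp
    linear_combination ((s : ℂ) ^ 2) * Complex.I_sq
  simp only [stripKernel, k0Kernel]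
  rw [e1, ofReal_mul_cpow (by positivity) hne, e2, e3, Complex.exp_add, ← Complex.ofReal_exp,
    abs_of_pos (by positivity), Complex.real_smul]
  push_cast
  field_simp

theorem complexK0_neg_I_mul_im {t : ℝ} (ht : 0 < t) :
    (complexK0 (-Complex.I * t)).im = Real.pi / 2 * besselJ0 t := by
  rw [besselJ0_eq_integral_stripKernel ht, integral_stripKernel_one ht]

/-! ### The Hankel function on the upper half plane -/

/-- The Hankel function `H₀⁽¹⁾` on the closed upper half plane. -/
noncomputable def hankelH0 (z : ℂ) : ℂ :=
  -(2 / Real.pi) * Complex.I * complexK0 (-Complex.I * z)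

theorem norm_hankelH0 (z : ℂ) : ‖hankelH0 z‖ = 2 / Real.pi * ‖complexK0 (-Complex.I * z)‖ := by
  simp [hankelH0, abs_of_pos Real.pi_pos]

theorem two_div_pi_le_one : 2 / Real.pi ≤ 1 := by
  rw [div_le_one Real.pi_pos]; exact Real.two_le_pi

theorem norm_hankelH0_le {z : ℂ} (hz : 0 ≤ z.im) (hz0 : z ≠ 0) :
    ‖hankelH0 z‖ ≤ 2 * Real.exp (-z.im) * ‖z‖ ^ (-(1 / 2) : ℝ) := by
  have h := norm_complexK0_le (w := -Complex.I * z) (by simpa using hz) (by simpa using hz0)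
  rw [norm_hankelH0]
  refine (mul_le_of_le_one_left (norm_nonneg _) two_div_pi_le_one).trans (h.trans (le_of_eq ?_))
  simp

theorem exists_norm_hankelH0_le_rpow : ∃ C : ℝ, 0 ≤ C ∧ ∀ z : ℂ, 0 ≤ z.im → z ≠ 0 →
    ‖hankelH0 z‖ ≤ C * ‖z‖ ^ (-(1 / 8) : ℝ) := by
  obtain ⟨C, hC, h⟩ := exists_norm_complexK0_le_rpow
  refine ⟨C, hC, fun z hz hz0 => ?_⟩
  rw [norm_hankelH0]
  refine (mul_le_of_le_one_left (norm_nonneg _) two_div_pi_le_one).trans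
    ((h (-Complex.I * z) (by simpa using hz) (by simpa using hz0)).trans (le_of_eq ?_))
  simp

theorem continuousOn_hankelH0 : ContinuousOn hankelH0 {z | 0 ≤ z.im ∧ z ≠ 0} := by
  refine ContinuousOn.mul (by fun_prop) (continuousOn_complexK0.comp (by fun_prop) fun z hz => ?_)
  simpa using hz

theorem differentiableAt_hankelH0 {z : ℂ} (hz : 0 < z.im) : DifferentiableAt ℂ hankelH0 z := by
  refine DifferentiableAt.const_mul ?_ _
  exact DifferentiableAt.comp z (differentiableAt_complexK0 (by simpa using hz)) (by fun_prop)

theorem hankelH0_ofReal_re {t : ℝ} (ht : 0 < t) : (hankelH0 t).re = besselJ0 t := by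
  have hpi := Real.pi_ne_zero
  have h := complexK0_neg_I_mul_im ht
  have : hankelH0 t = ((2 / Real.pi : ℝ) : ℂ) * (-Complex.I * complexK0 (-Complex.I * t)) := by
    rw [hankelH0]; push_cast; ring
  rw [this, Complex.re_ofReal_mul]
  simp only [neg_mul, Complex.neg_re, Complex.I_mul_re, neg_neg] at h ⊢
  rw [h]
  field_simp

theorem hankelH0_mul_I {t : ℝ} (ht : 0 < t) :
    hankelH0 (t * Complex.I) = ((-(2 / Real.pi * besselK0 t) : ℝ) : ℂ) * Complex.I := by
  have : -Complex.I * (t * Complex.I) = t := by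
    linear_combination (-(t : ℂ)) * Complex.I_sq
  rw [hankelH0, this, complexK0_ofReal ht]
  push_cast
  ring

/-! ### The contour integrand and its estimates -/

/-- The combination of products of Bessel functions whose real part on the real axis is
`J₀ ^ 7 / 35`. -/
noncomputable def besselPoly (j h : ℂ) : ℂ :=
  j * h ^ 6 / 16 + j ^ 3 * h ^ 4 / 8 - h ^ 7 / 112 - 3 * (j ^ 2 * h ^ 5) / 20

/-- With `h = j + iy`, the four coefficients are chosen so that the terms in `y²`, `y⁴` and `y⁶` of
the real part cancel; what remains is `1/16 + 1/8 - 1/112 - 3/20 = 1/35`. -/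
theorem besselPoly_re_of_re_eq (j : ℝ) {h : ℂ} (hh : h.re = j) :
    (besselPoly j h).re = j ^ 7 / 35 := by
  have : h = j + h.im * Complex.I := by
    rw [← hh]; exact (Complex.re_add_im h).symm
  rw [this, besselPoly]
  generalize h.im = y
  simp [pow_succ]
  ring

/-- The odd powers `h⁵` and `h⁷` become purely imaginary, leaving only the two products in the
theorem. -/
theorem besselPoly_mul_I_re (j k : ℝ) :
    (besselPoly j (k * Complex.I)).re = j ^ 3 * k ^ 4 / 8 - j * k ^ 6 / 16 := by
  simp [besselPoly, pow_succ]
  ring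

theorem norm_besselPoly_le (j h : ℂ) : ‖besselPoly j h‖ ≤
    ‖j‖ * ‖h‖ ^ 6 / 16 + ‖j‖ ^ 3 * ‖h‖ ^ 4 / 8 + ‖h‖ ^ 7 / 112 + 3 * (‖j‖ ^ 2 * ‖h‖ ^ 5) / 20 := by
  refine (norm_sub_le _ _).trans (add_le_add ((norm_sub_le _ _).trans
    (add_le_add ((norm_add_le _ _).trans (add_le_add ?_ ?_)) ?_)) ?_) <;>
  simp

/-- The function integrated along the boundary of the first quadrant. -/
noncomputable def quadrantKernel (x : ℝ) (z : ℂ) : ℂ :=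
  complexJ0 (x * z) * z * besselPoly (complexJ0 z) (hankelH0 z)

theorem norm_complexJ0_mul_le {x : ℝ} (hx : x ∈ Icc (0 : ℝ) 1) {z : ℂ} (hz : 0 ≤ z.im) :
    ‖complexJ0 (x * z)‖ ≤ Real.exp z.im := by
  refine (norm_complexJ0_le _).trans ?_
  rw [Complex.im_ofReal_mul]
  exact (besselI0_le_exp (mul_nonneg hx.1 hz)).trans
    (Real.exp_le_exp.2 (mul_le_of_le_one_left hz hx.2))

theorem norm_complexJ0_le_exp {z : ℂ} (hz : 0 ≤ z.im) : ‖complexJ0 z‖ ≤ Real.exp z.im := by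
  simpa using norm_complexJ0_mul_le (x := 1) (by simp) hz

/-- Below, `E = e^(Im z)`, `e = 1/E` and `q = ‖z‖^(-1/2)`. No term has more factors `E` than `e`,
and every term has at least `q⁴ = ‖z‖⁻²`. Terms with a fifth factor `q` go into the second summand.
-/
theorem norm_quadrantKernel_le {x : ℝ} (hx : x ∈ Icc (0 : ℝ) 1) {z : ℂ} (hz : 0 < z.im)
    (hz1 : 1 ≤ ‖z‖) : ‖quadrantKernel x z‖ ≤
      ‖z‖⁻¹ * (2 * z.im ^ (-(1 / 2) : ℝ) + 16 * ‖z‖ ^ (-(1 / 2) : ℝ)) := by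
  have hz0 : z ≠ 0 := by rintro rfl; simp at hz
  have hpos : 0 < ‖z‖ := by linarith
  have hj' : ‖complexJ0 z‖ ≤ Real.exp z.im * z.im ^ (-(1 / 2) : ℝ) :=
    (norm_complexJ0_le z).trans (besselI0_le_exp_mul_rpow hz)
  have hj := norm_complexJ0_le_exp hz.le
  have hx' := norm_complexJ0_mul_le hx hz.le
  have hh := norm_hankelH0_le hz.le hz0
  have hp := norm_besselPoly_le (complexJ0 z) (hankelH0 z)
  set q := ‖z‖ ^ (-(1 / 2) : ℝ) with hq
  set p := z.im ^ (-(1 / 2) : ℝ) with hpdef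
  have hp0 : 0 ≤ p := by positivity
  have hq0 : 0 ≤ q := by positivity
  have hq1 : q ≤ 1 := Real.rpow_le_one_of_one_le_of_nonpos hz1 (by norm_num)
  have hq2 : q ^ 2 = ‖z‖⁻¹ := by
    rw [hq, ← Real.rpow_natCast, ← Real.rpow_mul hpos.le, ← Real.rpow_neg_one]; norm_num
  set E := Real.exp z.im with hE
  have hE0 : 0 < E := Real.exp_pos _
  have hE1 : 1 ≤ E := Real.one_le_exp hz.le
  rw [Real.exp_neg] at hh
  set e := E⁻¹ with he
  have he0 : 0 < e := by positivity
  have he1 : e ≤ 1 := inv_le_one_of_one_le₀ hE1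
  have hEe : E * e = 1 := mul_inv_cancel₀ hE0.ne'
  -- Only the term in `j³h⁴` has no spare `q`, so one of its three factors `J₀` takes the sharper
  -- bound.
  have hcube : ‖complexJ0 z‖ ^ 3 ≤ E ^ 3 * p := by
    calc ‖complexJ0 z‖ ^ 3 = ‖complexJ0 z‖ ^ 2 * ‖complexJ0 z‖ := by ring
      _ ≤ E ^ 2 * (E * p) := by gcongr
      _ = E ^ 3 * p := by ring
  have hP : ‖besselPoly (complexJ0 z) (hankelH0 z)‖ ≤
      E * (2 * e * q) ^ 6 / 16 + E ^ 3 * p * (2 * e * q) ^ 4 / 8 + (2 * e * q) ^ 7 / 112 +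
        3 * (E ^ 2 * (2 * e * q) ^ 5) / 20 := by
    refine hp.trans ?_
    gcongr
  have hfin : E * (E * (2 * e * q) ^ 6 / 16 + E ^ 3 * p * (2 * e * q) ^ 4 / 8 +
      (2 * e * q) ^ 7 / 112 + 3 * (E ^ 2 * (2 * e * q) ^ 5) / 20) ≤ q ^ 4 * (2 * p + 16 * q) := by
    have e1 : E * (E * (2 * e * q) ^ 6 / 16 + E ^ 3 * p * (2 * e * q) ^ 4 / 8 +
      (2 * e * q) ^ 7 / 112 + 3 * (E ^ 2 * (2 * e * q) ^ 5) / 20) =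
      q ^ 4 * (4 * ((E * e) ^ 2 * e ^ 4) * q ^ 2 + 2 * (E * e) ^ 4 * p +
        8 / 7 * ((E * e) * e ^ 6) * q ^ 3 + 24 / 5 * ((E * e) ^ 3 * e ^ 2) * q) := by ring
    rw [e1, hEe]
    have h2 : e ^ 2 ≤ 1 := pow_le_one₀ he0.le he1
    have h4 : e ^ 4 ≤ 1 := pow_le_one₀ he0.le he1
    have h6 : e ^ 6 ≤ 1 := pow_le_one₀ he0.le he1
    have k2 : q ^ 2 ≤ q := pow_le_of_le_one hq0 hq1 two_ne_zero
    have k3 : q ^ 3 ≤ q := pow_le_of_le_one hq0 hq1 three_ne_zero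
    have m2 : e ^ 2 * q ≤ 1 * q := by gcongr
    have m4 : e ^ 4 * q ^ 2 ≤ 1 * q := by gcongr
    have m6 : e ^ 6 * q ^ 3 ≤ 1 * q := by gcongr
    refine mul_le_mul_of_nonneg_left ?_ (by positivity)
    linarith
  have hz2 : ‖z‖ * q ^ 4 = ‖z‖⁻¹ := by
    rw [show q ^ 4 = q ^ 2 * q ^ 2 by ring, hq2]; field_simp
  rw [quadrantKernel, norm_mul, norm_mul]
  calc _ ≤ E * ‖z‖ * (E * (2 * e * q) ^ 6 / 16 + E ^ 3 * p * (2 * e * q) ^ 4 / 8 +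
        (2 * e * q) ^ 7 / 112 + 3 * (E ^ 2 * (2 * e * q) ^ 5) / 20) := by gcongr
    _ = ‖z‖ * (E * (E * (2 * e * q) ^ 6 / 16 + E ^ 3 * p * (2 * e * q) ^ 4 / 8 +
        (2 * e * q) ^ 7 / 112 + 3 * (E ^ 2 * (2 * e * q) ^ 5) / 20)) := by ring
    _ ≤ ‖z‖ * (q ^ 4 * (2 * p + 16 * q)) := by gcongr
    _ = _ := by rw [← mul_assoc, hz2]

theorem exists_norm_quadrantKernel_le_rpow {x : ℝ} (hx : x ∈ Icc (0 : ℝ) 1) :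
    ∃ C : ℝ, ∀ z : ℂ, 0 ≤ z.im → ‖z‖ ≤ 1 →
      ‖quadrantKernel x z‖ ≤ C * ‖z‖ ^ (1 / 8 : ℝ) := by
  obtain ⟨C, hC, h⟩ := exists_norm_hankelH0_le_rpow
  refine ⟨15 * (C + 1) ^ 7, fun z hz hz1 => ?_⟩
  rcases eq_or_ne z 0 with rfl | hz0
  · simp [quadrantKernel]
  have hpos : 0 < ‖z‖ := norm_pos_iff.2 hz0
  set b := ‖z‖ ^ (-(1 / 8) : ℝ) with hb
  have hb1 : 1 ≤ b := Real.one_le_rpow_of_pos_of_le_one_of_nonpos hpos hz1 (by norm_num)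
  have hb7 : ‖z‖ * b ^ 7 = ‖z‖ ^ (1 / 8 : ℝ) := by
    rw [hb, ← Real.rpow_natCast, ← Real.rpow_mul hpos.le]
    nth_rewrite 1 [← Real.rpow_one ‖z‖]
    rw [← Real.rpow_add hpos]; norm_num
  have him : z.im ≤ 1 := (Complex.im_le_norm z).trans hz1
  have hE : Real.exp z.im ≤ 3 :=
    (Real.exp_le_exp.2 him).trans (Real.exp_one_lt_d9.le.trans (by norm_num))
  have hj := (norm_complexJ0_le_exp hz).trans hE
  have hx' := (norm_complexJ0_mul_le hx hz).trans hE
  set M := (C + 1) * b with hM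
  have hM1 : 1 ≤ M := by nlinarith
  have hh : ‖hankelH0 z‖ ≤ M := (h z hz hz0).trans (by rw [hM]; nlinarith)
  have hP : ‖besselPoly (complexJ0 z) (hankelH0 z)‖ ≤ 5 * M ^ 7 := by
    have h4 : M ^ 4 ≤ M ^ 7 := pow_le_pow_right₀ hM1 (by norm_num)
    have h5 : M ^ 5 ≤ M ^ 7 := pow_le_pow_right₀ hM1 (by norm_num)
    have h6 : M ^ 6 ≤ M ^ 7 := pow_le_pow_right₀ hM1 (by norm_num)
    have h7 : 0 ≤ M ^ 7 := by positivity
    calc _ ≤ _ := norm_besselPoly_le _ _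
      _ ≤ 3 * M ^ 6 / 16 + 3 ^ 3 * M ^ 4 / 8 + M ^ 7 / 112 + 3 * (3 ^ 2 * M ^ 5) / 20 := by gcongr
      _ ≤ 5 * M ^ 7 := by linarith
  rw [quadrantKernel, norm_mul, norm_mul]
  calc _ ≤ 3 * ‖z‖ * (5 * M ^ 7) := by gcongr
    _ = 15 * (C + 1) ^ 7 * (‖z‖ * b ^ 7) := by rw [hM]; ring
    _ = _ := by rw [hb7]

/-- At the origin the factor `z` beats the singularity of `H⁷`, so the contour needs no indentation
there. -/
theorem continuousOn_quadrantKernel {x : ℝ} (hx : x ∈ Icc (0 : ℝ) 1) :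
    ContinuousOn (quadrantKernel x) {z | 0 ≤ z.im} := by
  intro z hz
  rcases eq_or_ne z 0 with rfl | hz0
  · obtain ⟨C, hC⟩ := exists_norm_quadrantKernel_le_rpow hx
    have h0 : quadrantKernel x 0 = 0 := by simp [quadrantKernel]
    rw [ContinuousWithinAt, h0]
    have hlim : Tendsto (fun z : ℂ => C * ‖z‖ ^ (1 / 8 : ℝ)) (𝓝[{z | 0 ≤ z.im}] 0) (𝓝 0) := by
      have : ContinuousAt (fun z : ℂ => C * ‖z‖ ^ (1 / 8 : ℝ)) 0 :=
        continuousAt_const.mul (continuousAt_id.norm.rpow_const (Or.inr (by norm_num)))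
      have h := this.tendsto.mono_left (nhdsWithin_le_nhds (s := {z : ℂ | 0 ≤ z.im}))
      simpa using h
    refine squeeze_zero_norm' ?_ hlim
    filter_upwards [self_mem_nhdsWithin, nhdsWithin_le_nhds (Metric.closedBall_mem_nhds 0 one_pos)]
      with z hz hz1 using hC z hz (by simpa using hz1)
  · have hH : ContinuousWithinAt hankelH0 {z | 0 ≤ z.im} z := by
      refine (continuousOn_hankelH0 z ⟨hz, hz0⟩).mono_of_mem_nhdsWithin ?_
      filter_upwards [self_mem_nhdsWithin, nhdsWithin_le_nhds (isOpen_ne.mem_nhds hz0)]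
        with w hw hw0 using ⟨hw, hw0⟩
    have hJ : ContinuousWithinAt complexJ0 {z | 0 ≤ z.im} z :=
      continuous_complexJ0.continuousWithinAt
    have hJx : ContinuousWithinAt (fun z => complexJ0 (x * z)) {z | 0 ≤ z.im} z := by fun_prop
    unfold quadrantKernel besselPoly
    fun_prop

theorem differentiableAt_quadrantKernel (x : ℝ) {z : ℂ} (hz : 0 < z.im) :
    DifferentiableAt ℂ (quadrantKernel x) z := by
  have hH := differentiableAt_hankelH0 hz
  have hJ := differentiable_complexJ0 z
  have hJx : DifferentiableAt ℂ (fun z => complexJ0 (x * z)) z :=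
    (differentiable_complexJ0 (x * z)).comp z (f := fun z : ℂ => x * z) (by fun_prop)
  unfold quadrantKernel besselPoly
  fun_prop

theorem quadrantKernel_rect {x : ℝ} (hx : x ∈ Icc (0 : ℝ) 1) {R : ℝ} (hR : 0 < R) :
    (∫ s in (0 : ℝ)..R, quadrantKernel x s) -
      (∫ s in (0 : ℝ)..R, quadrantKernel x (s + R * Complex.I)) +
      Complex.I * (∫ y in (0 : ℝ)..R, quadrantKernel x (R + y * Complex.I)) -
      Complex.I * (∫ y in (0 : ℝ)..R, quadrantKernel x (y * Complex.I)) = 0 := by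
  have h := Complex.integral_boundary_rect_eq_zero_of_continuousOn_of_differentiableOn
    (quadrantKernel x) 0 (R + R * Complex.I) ((continuousOn_quadrantKernel hx).mono fun z hz => by
      simp only [Complex.zero_re, Complex.zero_im, Complex.add_re, Complex.add_im,
        Complex.ofReal_re, Complex.ofReal_im, Complex.re_ofReal_mul, Complex.im_ofReal_mul,
        Complex.I_re, Complex.I_im, mul_zero, mul_one, add_zero, zero_add,
        uIcc_of_le hR.le, Complex.mem_reProdIm] at hz
      exact hz.2.1)
    (fun z hz => by
      simp only [Complex.zero_re, Complex.zero_im, Complex.add_re, Complex.add_im,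
        Complex.ofReal_re, Complex.ofReal_im, Complex.re_ofReal_mul, Complex.im_ofReal_mul,
        Complex.I_re, Complex.I_im, mul_zero, mul_one, add_zero, zero_add,
        min_eq_left hR.le, max_eq_right hR.le, Complex.mem_reProdIm] at hz
      exact (differentiableAt_quadrantKernel x hz.2.1).differentiableWithinAt)
  simpa using h

theorem tendsto_quadrantKernel_top {x : ℝ} (hx : x ∈ Icc (0 : ℝ) 1) :
    Tendsto (fun R : ℝ => ∫ s in (0 : ℝ)..R, quadrantKernel x (s + R * Complex.I)) atTop (𝓝 0) := by
  have hb : Tendsto (fun R : ℝ => 18 * R ^ (-(1 / 2) : ℝ)) atTop (𝓝 0) := by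
    simpa using (tendsto_rpow_neg_atTop (by norm_num : (0 : ℝ) < 1 / 2)).const_mul 18
  refine squeeze_zero_norm' ?_ hb
  filter_upwards [eventually_ge_atTop 1] with R hR
  have hR0 : 0 < R := by linarith
  have h : ∀ s ∈ uIoc 0 R, ‖quadrantKernel x (s + R * Complex.I)‖ ≤
      R⁻¹ * (2 * R ^ (-(1 / 2) : ℝ) + 16 * R ^ (-(1 / 2) : ℝ)) := by
    intro s _
    set z : ℂ := s + R * Complex.I with hz
    have him : z.im = R := by simp [hz]
    have hn : R ≤ ‖z‖ := him ▸ Complex.im_le_norm z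
    have := norm_quadrantKernel_le hx (z := z) (by linarith) (by linarith)
    rw [him] at this
    have h2 := Real.rpow_le_rpow_of_nonpos hR0 hn (by norm_num : (-(1 / 2) : ℝ) ≤ 0)
    refine this.trans ?_
    gcongr
  refine (intervalIntegral.norm_integral_le_of_norm_le_const h).trans (le_of_eq ?_)
  rw [sub_zero, abs_of_pos hR0]
  field_simp
  ring

/-- The bound blows up at the real axis, but `y^(-1/2)` is integrable: `∫ (2 y^(-1/2) + 16 R^(-1/2))
dy = 20 R^(1/2)` over `[0, R]`, to be divided by `R`. -/
theorem tendsto_quadrantKernel_right {x : ℝ} (hx : x ∈ Icc (0 : ℝ) 1) :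
    Tendsto (fun R : ℝ => ∫ y in (0 : ℝ)..R, quadrantKernel x (R + y * Complex.I)) atTop (𝓝 0) := by
  have hb : Tendsto (fun R : ℝ => 20 * R ^ (-(1 / 2) : ℝ)) atTop (𝓝 0) := by
    simpa using (tendsto_rpow_neg_atTop (by norm_num : (0 : ℝ) < 1 / 2)).const_mul 20
  refine squeeze_zero_norm' ?_ hb
  filter_upwards [eventually_ge_atTop 1] with R hR
  have hR0 : 0 < R := by linarith
  have h : ∀ y ∈ Ioc 0 R, ‖quadrantKernel x (R + y * Complex.I)‖ ≤
      R⁻¹ * (2 * y ^ (-(1 / 2) : ℝ) + 16 * R ^ (-(1 / 2) : ℝ)) := by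
    intro y hy
    set z : ℂ := R + y * Complex.I with hz
    have him : z.im = y := by simp [hz]
    have hre : z.re = R := by simp [hz]
    have hn : R ≤ ‖z‖ := hre ▸ Complex.re_le_norm z
    have := norm_quadrantKernel_le hx (z := z) (by linarith [hy.1]) (by linarith)
    rw [him] at this
    have h2 := Real.rpow_le_rpow_of_nonpos hR0 hn (by norm_num : (-(1 / 2) : ℝ) ≤ 0)
    have h3 : 0 ≤ y ^ (-(1 / 2) : ℝ) := Real.rpow_nonneg hy.1.le _
    refine this.trans ?_
    gcongr
  have hint : IntervalIntegrable (fun y : ℝ => y ^ (-(1 / 2) : ℝ)) volume 0 R :=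
    intervalIntegral.intervalIntegrable_rpow' (by norm_num)
  refine (intervalIntegral.norm_integral_le_of_norm_le hR0.le (Eventually.of_forall h)
    (((hint.const_mul 2).add (by simp)).const_mul _)).trans (le_of_eq ?_)
  have hhalf : R ^ (1 / 2 : ℝ) = R * R ^ (-(1 / 2) : ℝ) := by
    nth_rewrite 2 [← Real.rpow_one R]
    rw [← Real.rpow_add hR0]; norm_num
  rw [intervalIntegral.integral_const_mul, intervalIntegral.integral_add (hint.const_mul 2)
    (by simp), intervalIntegral.integral_const_mul, integral_rpow (Or.inl (by norm_num)),
    intervalIntegral.integral_const]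
  norm_num
  rw [hhalf]
  field_simp
  ring

theorem quadrantKernel_ofReal_re (x : ℝ) {t : ℝ} (ht : 0 < t) :
    (quadrantKernel x t).re = besselJ0 (x * t) * besselJ0 t ^ 7 * t / 35 := by
  have h := besselPoly_re_of_re_eq (besselJ0 t) (hankelH0_ofReal_re ht)
  rw [quadrantKernel, ← Complex.ofReal_mul, complexJ0_ofReal, complexJ0_ofReal,
    ← Complex.ofReal_mul, Complex.re_ofReal_mul, h]
  ring

theorem quadrantKernel_mul_I_im (x : ℝ) {t : ℝ} (ht : 0 < t) :
    (quadrantKernel x (t * Complex.I)).im =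
      -(4 / Real.pi ^ 6 * (besselI0 (x * t) * besselI0 t * besselK0 t ^ 6 * t) -
        2 / Real.pi ^ 4 * (besselI0 (x * t) * besselI0 t ^ 3 * besselK0 t ^ 4 * t)) := by
  have hpi := Real.pi_ne_zero
  rw [quadrantKernel, ← mul_assoc (x : ℂ), ← Complex.ofReal_mul, complexJ0_mul_I, complexJ0_mul_I,
    hankelH0_mul_I ht, ← mul_assoc, ← Complex.ofReal_mul, mul_assoc, Complex.im_ofReal_mul,
    Complex.I_mul_im, besselPoly_mul_I_re]
  field_simp
  ring

/-! ### Absolute convergence of the Bessel integrals -/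

theorem integrableOn_Ioi_of_bounds {f : ℝ → ℝ} (hf : ContinuousOn f (Ioi 0)) {A B : ℝ}
    (h0 : ∀ t, 0 < t → t ≤ 1 → |f t| ≤ A) (h1 : ∀ t, 1 < t → |f t| ≤ B * t ^ (-2 : ℝ)) :
    IntegrableOn f (Ioi 0) := by
  rw [← Ioc_union_Ioi_eq_Ioi (zero_le_one' ℝ)]
  refine IntegrableOn.union ?_ ?_
  · refine Integrable.mono' (g := fun _ => A) (by simp)
      ((hf.mono Ioc_subset_Ioi_self).aestronglyMeasurable measurableSet_Ioc) ?_
    filter_upwards [ae_restrict_mem measurableSet_Ioc] with t ht using h0 t ht.1 ht.2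
  · refine Integrable.mono' ((integrableOn_Ioi_rpow_of_lt (by norm_num : (-2 : ℝ) < -1)
      one_pos).const_mul B) ((hf.mono (Ioi_subset_Ioi zero_le_one)).aestronglyMeasurable
      measurableSet_Ioi) ?_
    filter_upwards [ae_restrict_mem measurableSet_Ioi] with t ht using h1 t ht

theorem besselI0_mul_le_exp {x : ℝ} (hx : x ∈ Icc (0 : ℝ) 1) {t : ℝ} (ht : 0 ≤ t) :
    besselI0 (x * t) ≤ Real.exp t :=
  (besselI0_le_exp (mul_nonneg hx.1 ht)).trans
    (Real.exp_le_exp.2 (mul_le_of_le_one_left ht hx.2))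

theorem rpow_neg_half_sq {t : ℝ} (ht : 0 < t) : (t ^ (-(1 / 2) : ℝ)) ^ 2 = t⁻¹ := by
  rw [← Real.rpow_natCast, ← Real.rpow_mul ht.le, ← Real.rpow_neg_one]; norm_num

theorem rpow_neg_two {t : ℝ} (ht : 0 < t) : t ^ (-2 : ℝ) = (t⁻¹) ^ 2 := by
  rw [Real.rpow_neg ht.le, inv_pow]; norm_cast

theorem exists_besselK0_pow_mul_le {n : ℕ} (hn : n ≤ 8) :
    ∃ C : ℝ, 0 ≤ C ∧ ∀ t : ℝ, 0 < t → t ≤ 1 → besselK0 t ^ n * t ≤ C := by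
  obtain ⟨C, hC, h⟩ := exists_besselK0_le_rpow
  refine ⟨C ^ n, by positivity, fun t ht ht1 => ?_⟩
  have hb1 : 1 ≤ t ^ (-(1 / 8) : ℝ) :=
    Real.one_le_rpow_of_pos_of_le_one_of_nonpos ht ht1 (by norm_num)
  have hb8 : (t ^ (-(1 / 8) : ℝ)) ^ 8 * t = 1 := by
    rw [← Real.rpow_natCast, ← Real.rpow_mul ht.le]
    norm_num [Real.rpow_neg_one, ht.ne']
  have hK := besselK0_nonneg t
  calc besselK0 t ^ n * t ≤ (C * t ^ (-(1 / 8) : ℝ)) ^ n * t := by gcongr; exact h t ht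
    _ = C ^ n * ((t ^ (-(1 / 8) : ℝ)) ^ n * t) := by ring
    _ ≤ C ^ n * ((t ^ (-(1 / 8) : ℝ)) ^ 8 * t) := by gcongr
    _ = C ^ n := by rw [hb8, mul_one]

theorem abs_besselJ0_le {t : ℝ} (ht : 0 < t) : |besselJ0 t| ≤ 2 * t ^ (-(1 / 2) : ℝ) := by
  rw [← hankelH0_ofReal_re ht]
  refine (Complex.abs_re_le_norm _).trans
    ((norm_hankelH0_le (z := t) (by simp) (by simpa using ht.ne')).trans (le_of_eq ?_))
  simp [abs_of_pos ht]

theorem integrableOn_besselJ0_pow (x : ℝ) :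
    IntegrableOn (fun t => besselJ0 (x * t) * besselJ0 t ^ 7 * t) (Ioi 0) := by
  have hle : ∀ t, 0 < t → |besselJ0 (x * t) * besselJ0 t ^ 7 * t| ≤ |besselJ0 t| ^ 6 * t := by
    intro t ht
    have h1 := abs_besselJ0_le_one (x * t)
    have h2 := abs_besselJ0_le_one t
    rw [abs_mul, abs_mul, abs_pow, abs_of_pos ht, pow_succ]
    -- Six factors `J₀` already give `t⁻³ · t = t⁻²`; the other two are bounded by `1`.
    calc _ ≤ 1 * (|besselJ0 t| ^ 6 * 1) * t := by gcongr
      _ = _ := by ring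
  refine integrableOn_Ioi_of_bounds (by fun_prop) (A := 1) (B := 64)
    (fun t ht ht1 => (hle t ht).trans ?_) (fun t ht1 => (hle t (by linarith)).trans ?_)
  · have h2 := abs_besselJ0_le_one t
    exact mul_le_one₀ (pow_le_one₀ (abs_nonneg _) h2) ht.le ht1
  · have ht : 0 < t := by linarith
    calc _ ≤ (2 * t ^ (-(1 / 2) : ℝ)) ^ 6 * t := by gcongr; exact abs_besselJ0_le ht
      _ = 64 * ((t ^ (-(1 / 2) : ℝ)) ^ 2) ^ 3 * t := by ring
      _ = _ := by rw [rpow_neg_half_sq ht, rpow_neg_two ht]; field_simp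

theorem integrableOn_besselI0_besselK0_six {x : ℝ} (hx : x ∈ Icc (0 : ℝ) 1) :
    IntegrableOn (fun t => besselI0 (x * t) * besselI0 t * besselK0 t ^ 6 * t) (Ioi 0) := by
  obtain ⟨C, hC, hK⟩ := exists_besselK0_pow_mul_le (n := 6) (by norm_num)
  have hc := continuousOn_besselK0
  have hnn : ∀ t, 0 < t → 0 ≤ besselI0 (x * t) * besselI0 t * besselK0 t ^ 6 * t := fun t ht =>
    mul_nonneg (mul_nonneg (mul_nonneg (besselI0_nonneg _) (besselI0_nonneg _))
      (pow_nonneg (besselK0_nonneg t) 6)) ht.le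
  refine integrableOn_Ioi_of_bounds (by fun_prop) (A := Real.exp 1 * Real.exp 1 * C) (B := 64)
    (fun t ht ht1 => ?_) (fun t ht1 => ?_)
  · rw [abs_of_nonneg (hnn t ht), mul_assoc _ _ t]
    have he : Real.exp t ≤ Real.exp 1 := Real.exp_le_exp.2 ht1
    have hk := mul_nonneg (pow_nonneg (besselK0_nonneg t) 6) ht.le
    have := besselI0_nonneg t
    gcongr
    · exact (besselI0_mul_le_exp hx ht.le).trans he
    · exact (besselI0_le_exp ht.le).trans he
    · exact hK t ht ht1
  · have ht : 0 < t := by linarith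
    have hk := besselK0_nonneg t
    have := besselI0_nonneg t
    rw [abs_of_nonneg (hnn t ht)]
    calc _ ≤ Real.exp t * Real.exp t * (2 * Real.exp (-t) * t ^ (-(1 / 2) : ℝ)) ^ 6 * t := by
          gcongr
          · exact besselI0_mul_le_exp hx ht.le
          · exact besselI0_le_exp ht.le
          · exact besselK0_le ht
      _ = 64 * (Real.exp t * Real.exp (-t)) ^ 2 * Real.exp (-t) ^ 4 *
          ((t ^ (-(1 / 2) : ℝ)) ^ 2) ^ 3 * t := by ring
      _ ≤ 64 * (Real.exp t * Real.exp (-t)) ^ 2 * 1 * ((t ^ (-(1 / 2) : ℝ)) ^ 2) ^ 3 * t := by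
          gcongr
          exact pow_le_one₀ (Real.exp_pos _).le (Real.exp_le_one_iff.2 (by linarith))
      _ = _ := by
          rw [← Real.exp_add, add_neg_cancel, Real.exp_zero, rpow_neg_half_sq ht, rpow_neg_two ht]
          field_simp

theorem integrableOn_besselI0_pow_besselK0_four {x : ℝ} (hx : x ∈ Icc (0 : ℝ) 1) :
    IntegrableOn (fun t => besselI0 (x * t) * besselI0 t ^ 3 * besselK0 t ^ 4 * t) (Ioi 0) := by
  obtain ⟨C, hC, hK⟩ := exists_besselK0_pow_mul_le (n := 4) (by norm_num)
  have hc := continuousOn_besselK0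
  have hnn : ∀ t, 0 < t → 0 ≤ besselI0 (x * t) * besselI0 t ^ 3 * besselK0 t ^ 4 * t := fun t ht =>
    mul_nonneg (mul_nonneg (mul_nonneg (besselI0_nonneg _) (pow_nonneg (besselI0_nonneg _) 3))
      (pow_nonneg (besselK0_nonneg t) 4)) ht.le
  refine integrableOn_Ioi_of_bounds (by fun_prop) (A := Real.exp 1 * Real.exp 1 ^ 3 * C) (B := 16)
    (fun t ht ht1 => ?_) (fun t ht1 => ?_)
  · rw [abs_of_nonneg (hnn t ht), mul_assoc _ _ t]
    have he : Real.exp t ≤ Real.exp 1 := Real.exp_le_exp.2 ht1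
    have hk := mul_nonneg (pow_nonneg (besselK0_nonneg t) 4) ht.le
    have := besselI0_nonneg t
    gcongr
    · exact (besselI0_mul_le_exp hx ht.le).trans he
    · exact (besselI0_le_exp ht.le).trans he
    · exact hK t ht ht1
  · have ht : 0 < t := by linarith
    have hk := besselK0_nonneg t
    have hi := besselI0_nonneg t
    rw [abs_of_nonneg (hnn t ht), pow_succ (besselI0 t)]
    -- The exponentials cancel exactly. Two sharp bounds on `I₀` and four on `K₀` give `t⁻³`, hence
    -- `t⁻²` after the factor `t`.
    calc _ ≤ Real.exp t * ((Real.exp t * t ^ (-(1 / 2) : ℝ)) ^ 2 * Real.exp t) *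
          (2 * Real.exp (-t) * t ^ (-(1 / 2) : ℝ)) ^ 4 * t := by
          gcongr
          · exact besselI0_mul_le_exp hx ht.le
          · exact besselI0_le_exp_mul_rpow ht
          · exact besselI0_le_exp ht.le
          · exact besselK0_le ht
      _ = 16 * (Real.exp t * Real.exp (-t)) ^ 4 * ((t ^ (-(1 / 2) : ℝ)) ^ 2) ^ 3 * t := by ring
      _ = _ := by
          rw [← Real.exp_add, add_neg_cancel, Real.exp_zero, rpow_neg_half_sq ht, rpow_neg_two ht]
          field_simp

/-! ### Rotating the contour -/

theorem integral_besselJ0_pow_eq {x : ℝ} (hx : x ∈ Icc (0 : ℝ) 1) :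
    (∫ t in Ioi (0 : ℝ), besselJ0 (x * t) * besselJ0 t ^ 7 * t / 35) =
      ∫ t in Ioi (0 : ℝ),
        (4 / Real.pi ^ 6 * (besselI0 (x * t) * besselI0 t * besselK0 t ^ 6 * t) -
          2 / Real.pi ^ 4 * (besselI0 (x * t) * besselI0 t ^ 3 * besselK0 t ^ 4 * t)) := by
  have hJ := (integrableOn_besselJ0_pow x).div_const 35
  have hI := ((integrableOn_besselI0_besselK0_six hx).const_mul (4 / Real.pi ^ 6)).sub
    ((integrableOn_besselI0_pow_besselK0_four hx).const_mul (2 / Real.pi ^ 4))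
  have hlJ := intervalIntegral_tendsto_integral_Ioi 0 hJ tendsto_id
  have hlI := intervalIntegral_tendsto_integral_Ioi 0 hI tendsto_id
  have htop := (Complex.continuous_re.tendsto _).comp (tendsto_quadrantKernel_top hx)
  have hright := (Complex.continuous_im.tendsto _).comp (tendsto_quadrantKernel_right hx)
  have hsum := (hlI.add htop).add hright
  simp only [Complex.zero_re, Complex.zero_im, add_zero] at hsum
  refine tendsto_nhds_unique (hlJ.congr' ?_) hsum
  filter_upwards [eventually_gt_atTop 0] with R hR
  have h := congrArg Complex.re (quadrantKernel_rect hx hR)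
  have hcb : IntervalIntegrable (fun s : ℝ => quadrantKernel x s) volume 0 R :=
    ((continuousOn_quadrantKernel hx).comp (by fun_prop) fun s _ => by simp).intervalIntegrable
  have hcl : IntervalIntegrable (fun y : ℝ => quadrantKernel x (y * Complex.I)) volume 0 R :=
    ((continuousOn_quadrantKernel hx).comp (by fun_prop) fun y hy => by
      rw [uIcc_of_le hR.le] at hy
      simpa using hy.1).intervalIntegrable
  have hb : (∫ s in (0 : ℝ)..R, quadrantKernel x s).re =
      ∫ t in (0 : ℝ)..R, besselJ0 (x * t) * besselJ0 t ^ 7 * t / 35 := by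
    rw [← Complex.reCLM_apply, ← Complex.reCLM.intervalIntegral_comp_comm hcb]
    -- The half-open interval excludes `t = 0`, where the formula for the kernel is not available.
    refine intervalIntegral.integral_congr_ae (Eventually.of_forall fun t ht => ?_)
    rw [uIoc_of_le hR.le] at ht
    exact quadrantKernel_ofReal_re x ht.1
  have hl : (∫ y in (0 : ℝ)..R, quadrantKernel x (y * Complex.I)).im =
      -∫ t in (0 : ℝ)..R, (4 / Real.pi ^ 6 * (besselI0 (x * t) * besselI0 t * besselK0 t ^ 6 * t) -
        2 / Real.pi ^ 4 * (besselI0 (x * t) * besselI0 t ^ 3 * besselK0 t ^ 4 * t)) := by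
    rw [← Complex.imCLM_apply, ← Complex.imCLM.intervalIntegral_comp_comm hcl,
      ← intervalIntegral.integral_neg]
    refine intervalIntegral.integral_congr_ae (Eventually.of_forall fun t ht => ?_)
    rw [uIoc_of_le hR.le] at ht
    exact quadrantKernel_mul_I_im x ht.1
  simp only [Complex.sub_re, Complex.add_re, Complex.mul_re, Complex.I_re, Complex.I_im,
    Complex.zero_re, hb, hl] at h
  simp only [Function.comp, id, Pi.sub_apply]
  linarith

/-! ### The Maclaurin series -/

/-- The weight whose moments are the Maclaurin coefficients of the density. -/
noncomputable def bracketWeight (t : ℝ) : ℝ :=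
  (besselI0 t * besselK0 t ^ 6 - Real.pi ^ 2 / 2 * (besselI0 t ^ 3 * besselK0 t ^ 4)) * t

theorem integrableOn_besselI0_mul_bracketWeight {x : ℝ} (hx : x ∈ Icc (0 : ℝ) 1) :
    IntegrableOn (fun t => besselI0 (x * t) * bracketWeight t) (Ioi 0) := by
  refine ((integrableOn_besselI0_besselK0_six hx).sub
    ((integrableOn_besselI0_pow_besselK0_four hx).const_mul (Real.pi ^ 2 / 2))).congr
    (Eventually.of_forall fun t => ?_)
  simp only [Pi.sub_apply, bracketWeight]
  ring

theorem p7_eq_integral_bracketWeight {x : ℝ} (hx : x ∈ Icc (0 : ℝ) 1) :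
    p7 x = 140 / Real.pi ^ 6 * x * ∫ t in Ioi (0 : ℝ), besselI0 (x * t) * bracketWeight t := by
  have h := integral_besselJ0_pow_eq hx
  have h1 : p7 x = 35 * x * ∫ t in Ioi (0 : ℝ), besselJ0 (x * t) * besselJ0 t ^ 7 * t / 35 := by
    rw [p7, ← integral_const_mul]
    refine integral_congr_ae (Eventually.of_forall fun t => ?_)
    simp only [kluyverIntegrand7]
    ring
  rw [h1, h, ← integral_const_mul, ← integral_const_mul]
  refine integral_congr_ae (Eventually.of_forall fun t => ?_)
  have hpi := Real.pi_ne_zero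
  simp only [bracketWeight]
  field_simp
  ring

theorem p7_div_eq {x : ℝ} (hx : x ∈ Icc (0 : ℝ) 1) :
    p7 x / 35 =
      4 / Real.pi ^ 6 *
          (∫ t in Ioi (0 : ℝ), besselI0 (x * t) * besselI0 t * besselK0 t ^ 6 * (x * t)) -
        2 / Real.pi ^ 4 *
          (∫ t in Ioi (0 : ℝ), besselI0 (x * t) * besselI0 t ^ 3 * besselK0 t ^ 4 * (x * t)) := by
  have h6 := (integrableOn_besselI0_besselK0_six hx).const_mul x
  have h4 := (integrableOn_besselI0_pow_besselK0_four hx).const_mul x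
  have e6 : ∀ t, besselI0 (x * t) * besselI0 t * besselK0 t ^ 6 * (x * t) =
      x * (besselI0 (x * t) * besselI0 t * besselK0 t ^ 6 * t) := fun t => by ring
  have e4 : ∀ t, besselI0 (x * t) * besselI0 t ^ 3 * besselK0 t ^ 4 * (x * t) =
      x * (besselI0 (x * t) * besselI0 t ^ 3 * besselK0 t ^ 4 * t) := fun t => by ring
  simp only [e6, e4]
  rw [p7_eq_integral_bracketWeight hx, ← integral_const_mul, ← integral_const_mul,
    ← integral_const_mul, ← integral_sub (h6.const_mul _) (h4.const_mul _), ← integral_div]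
  refine integral_congr_ae (Eventually.of_forall fun t => ?_)
  have hpi := Real.pi_ne_zero
  simp only [bracketWeight]
  field_simp
  ring

/-- The terms of the power series of `I₀`. -/
noncomputable def besselI0Term (k : ℕ) (t : ℝ) : ℝ := t ^ (2 * k) / (4 ^ k * (k.factorial : ℝ) ^ 2)

theorem besselI0Term_nonneg (k : ℕ) (t : ℝ) : 0 ≤ besselI0Term k t :=
  div_nonneg ((even_two_mul k).pow_nonneg t) (by positivity)

theorem sum_besselI0Term_le (s : Finset ℕ) (t : ℝ) : ∑ k ∈ s, besselI0Term k t ≤ besselI0 t :=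
  sum_le_hasSum s (fun k _ => besselI0Term_nonneg k t) (hasSum_besselI0 t)

theorem integrableOn_norm_besselI0_mul_bracketWeight :
    IntegrableOn (fun t => besselI0 t * |bracketWeight t|) (Ioi 0) := by
  refine (integrableOn_besselI0_mul_bracketWeight (x := 1) (by simp)).norm.congr
    (Eventually.of_forall fun t => ?_)
  simp [abs_of_nonneg (besselI0_nonneg t)]

theorem integrableOn_besselI0Term_mul (k : ℕ) :
    IntegrableOn (fun t => besselI0Term k t * bracketWeight t) (Ioi 0) := by
  have hc := continuousOn_besselK0
  refine Integrable.mono' integrableOn_norm_besselI0_mul_bracketWeight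
    (ContinuousOn.aestronglyMeasurable (by unfold besselI0Term bracketWeight; fun_prop)
      measurableSet_Ioi) (Eventually.of_forall fun t => ?_)
  rw [norm_mul, Real.norm_eq_abs, Real.norm_eq_abs, abs_of_nonneg (besselI0Term_nonneg k t)]
  have := sum_besselI0Term_le {k} t
  rw [Finset.sum_singleton] at this
  gcongr

theorem momentIntegrand7_eq (k : ℕ) (t : ℝ) : momentIntegrand7 k t =
    4 ^ k * (k.factorial : ℝ) ^ 2 * (besselI0Term k t * bracketWeight t) := by
  rw [momentIntegrand7, besselI0Term, bracketWeight]
  field_simp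
  ring

theorem integrableOn_momentIntegrand7 (k : ℕ) : IntegrableOn (momentIntegrand7 k) (Ioi 0) := by
  rw [funext (momentIntegrand7_eq k)]
  exact (integrableOn_besselI0Term_mul k).const_mul _

theorem r7_eq (k : ℕ) : r7 k =
    140 / Real.pi ^ 6 * ∫ t in Ioi (0 : ℝ), besselI0Term k t * bracketWeight t := by
  have hpi := Real.pi_ne_zero
  rw [r7, funext (momentIntegrand7_eq k), integral_const_mul]
  field_simp

/-- Nonnegativity of the terms bounds every partial sum by the integral of `I₀ |bracketWeight|`,
finite by the case `x = 1`. The result supplies both the interchange of sum and integral and the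
majorant in the Weierstrass test. -/
theorem summable_integral_norm_besselI0Term_mul :
    Summable fun k => ∫ t in Ioi (0 : ℝ), ‖besselI0Term k t * bracketWeight t‖ := by
  refine summable_of_sum_le (c := ∫ t in Ioi (0 : ℝ), besselI0 t * |bracketWeight t|)
    (fun k => integral_nonneg fun t => norm_nonneg _) fun s => ?_
  rw [← integral_finsetSum _ fun k _ => (integrableOn_besselI0Term_mul k).norm]
  refine integral_mono (integrable_finsetSum _ fun k _ => (integrableOn_besselI0Term_mul k).norm)
    integrableOn_norm_besselI0_mul_bracketWeight fun t => ?_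
  simp only [norm_mul, Real.norm_eq_abs, abs_of_nonneg (besselI0Term_nonneg _ t)]
  rw [← Finset.sum_mul]
  exact mul_le_mul_of_nonneg_right (sum_besselI0Term_le s t) (abs_nonneg _)

theorem norm_r7_mul_pow_le {x : ℝ} (hx : x ∈ Icc (0 : ℝ) 1) (k : ℕ) :
    ‖r7 k * x ^ (2 * k + 1)‖ ≤
      140 / Real.pi ^ 6 * ∫ t in Ioi (0 : ℝ), ‖besselI0Term k t * bracketWeight t‖ := by
  have h1 : ‖x ^ (2 * k + 1)‖ ≤ 1 := by
    rw [norm_pow, Real.norm_eq_abs, abs_of_nonneg hx.1]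
    exact pow_le_one₀ hx.1 hx.2
  rw [norm_mul]
  refine (mul_le_of_le_one_right (norm_nonneg _) h1).trans ?_
  rw [r7_eq, norm_mul, Real.norm_of_nonneg (by positivity)]
  gcongr
  exact norm_integral_le_integral_norm _

theorem hasSum_p7 {x : ℝ} (hx : x ∈ Icc (0 : ℝ) 1) :
    HasSum (fun k => r7 k * x ^ (2 * k + 1)) (p7 x) := by
  have hterm : ∀ k t, besselI0Term k (x * t) * bracketWeight t =
      x ^ (2 * k) * (besselI0Term k t * bracketWeight t) := by
    intro k t
    rw [besselI0Term, besselI0Term, mul_pow]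
    ring
  have hle : ∀ k, |x ^ (2 * k)| ≤ 1 := fun k => by
    rw [abs_pow, abs_of_nonneg hx.1]; exact pow_le_one₀ hx.1 hx.2
  have h := hasSum_integral_of_summable_integral_norm (μ := volume.restrict (Ioi 0))
    (F := fun k t => besselI0Term k (x * t) * bracketWeight t)
    (fun k => by simpa only [hterm] using (integrableOn_besselI0Term_mul k).const_mul _)
    (by
      refine Summable.of_nonneg_of_le (fun k => integral_nonneg fun t => norm_nonneg _)
        (fun k => ?_) summable_integral_norm_besselI0Term_mul
      simp only [hterm, norm_mul (x ^ _), integral_const_mul]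
      exact mul_le_of_le_one_left (integral_nonneg fun t => norm_nonneg _) (hle k))
  have htsum : ∀ t, ∑' k, besselI0Term k (x * t) * bracketWeight t =
      besselI0 (x * t) * bracketWeight t := fun t =>
    ((hasSum_besselI0 (x * t)).mul_right (bracketWeight t)).tsum_eq
  simp only [htsum] at h
  rw [p7_eq_integral_bracketWeight hx]
  refine (h.mul_left (140 / Real.pi ^ 6 * x)).congr_fun fun k => ?_
  simp only [hterm]
  rw [integral_const_mul, r7_eq]
  ring

theorem mainTheorem8 :
    (∀ x ∈ Icc (0 : ℝ) 1,
      IntegrableOn (fun t => kluyverIntegrand7 x t) (Ioi 0) ∧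
      IntegrableOn (fun t => besselI0 (x * t) * besselI0 t * besselK0 t ^ 6 * t) (Ioi 0) ∧
      IntegrableOn (fun t => besselI0 (x * t) * besselI0 t ^ 3 * besselK0 t ^ 4 * t) (Ioi 0) ∧
      p7 x / 35 =
        4 / Real.pi ^ 6 *
            (∫ t in Ioi (0 : ℝ), besselI0 (x * t) * besselI0 t * besselK0 t ^ 6 * (x * t)) -
          2 / Real.pi ^ 4 *
            (∫ t in Ioi (0 : ℝ), besselI0 (x * t) * besselI0 t ^ 3 * besselK0 t ^ 4 * (x * t))) ∧
    (∀ k : ℕ, IntegrableOn (fun t => momentIntegrand7 k t) (Ioi 0)) ∧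
    TendstoUniformlyOn
      (fun (n : ℕ) (x : ℝ) => ∑ k ∈ Finset.range n, r7 k * x ^ (2 * k + 1))
      p7 atTop (Icc 0 1) := by
  refine ⟨fun x hx => ⟨?_, integrableOn_besselI0_besselK0_six hx,
    integrableOn_besselI0_pow_besselK0_four hx, p7_div_eq hx⟩, integrableOn_momentIntegrand7, ?_⟩
  · refine ((integrableOn_besselJ0_pow x).const_mul x).congr (Eventually.of_forall fun t => ?_)
    simp only [kluyverIntegrand7]
    ring
  · refine (tendstoUniformlyOn_tsum_nat (summable_integral_norm_besselI0Term_mul.mul_left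
      (140 / Real.pi ^ 6)) fun k x hx => norm_r7_mul_pow_le hx k).congr_right fun x hx => ?_
    exact (hasSum_p7 hx).tsum_eq
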